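/- All notions are those of Markov's constructive mathematics: "constructive" objects are given by algorithms, sequences are algorithmic sequences, and the points of $[0,1]$ are its constructive (computable) real points. A polygonal function is given by rational vertices $(p_k,q_k)_{k=0}^m$ with $0=p_0<\dots<p_m=1$, by linear interpolation; $\int_0^1$ of it is the sum of the trapezoid areas. Let $(\mathfrak A_N)_{N\ge 0}$ be an effective numbering of the normal algorithms in the alphabet $\{|,-,/,*,a,b\}$. Let $D$ be the set of all $N$ for which $\mathfrak A_N$, applied to the word $N$, halts with a result $*\delta*p_0*q_0*\dots*p_m*q_m*$, where $\delta>0$ is rational and $(p_k,q_k)_{k\le m}$ are the vertices of a polygonal function $g\ge 0$ with $\int_0^1 g<1/2$. Let $\mu:\mathbb N\to\mathbb N$ be an algorithm that enumerates $D$ without repetitions, and let $\delta_n$ and $g_n$ be the number and the function produced by $\mathfrak A_{\mu(n)}$ on $\mu(n)$. Let $(h_n)_{n\ge0}$ be a constructive sequence of polygonal functions with $0\le h_n\le h_{n+1}$, $\int_0^1 h_n<1/2$ and $\lim_n h_n(x)=2$ for every constructive $x\in[0,1]$. Let $\nu:\mathbb N\to\mathbb N$ be a constructive strictly increasing sequence,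 and let $(\zeta_n)$ in $(0,1)$ and $(\beta_n)$, $\beta_n>0$, be constructive sequences of rational numbers such that, for all $n$, $$\beta_n<\min(\delta_n,\zeta_n,1-\zeta_n),\qquad g_n(x)+h_{\nu(n)}(x)<1<h_{\nu(n+1)}(x)\quad\text{for all } x\in[\zeta_n-\beta_n,\zeta_n+\beta_n].$$ Put $$f_n(x)=2^{-\mu(n)}\max\Bigl(0,\,1-\frac{|x-\zeta_n|}{\beta_n}\Bigr),\qquad x\in[0,1].$$ For a function $u$ on $[0,1]$ put $[\omega(u,\eta)](x)=\sup\{|u(t)-u(s)| : t,s\in[x-\eta,x+\eta]\cap[0,1]\}$. Then: 1. There is an algorithm that finds for every constructive $x\in[0,1]$ (given by a program for $x$) a number $n$ with $f_k(x)=0$ for all $k\ge n$; in particular $\sum_k f_k(x)$ is a finite sum. 2. For all real $\varepsilon>0$ and all $n\in\mathbb N$ the function $\omega\bigl(\sum_{k=0}^n f_k,\varepsilon/16\bigr)$ is continuous on $[0,1]$, and $$\int_0^1\omega\Bigl(\sum_{k=0}^n f_k,\ \varepsilon/16\Bigr)<\varepsilon.$$ 3. There is a constructive function $f:[0,1]\to\mathbb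 R$ (an algorithm that turns programs for $x$ into programs for $f(x)$) with $f(x)=\sum_{k=0}^\infty f_k(x)$ for all constructive $x\in[0,1]$, and $f$ is constructively Riemann integrable: there are a constructive real $I$ and an algorithmic $r:\mathbb N\to\mathbb N$ such that every integral sum of $f$ for a tagged partition of $[0,1]$ (with constructive division points and tags) of mesh at most $2^{-r(k)}$ differs from $I$ by less than $2^{-k}$. -/

import Mathlib

open Set Filter Topology

/-! ### Constructive numbers, points and functions

Algorithms are programs for partial recursive functions (`Nat.Partrec.Code`). -/

/-- A standard numbering of the rational numbers: `⟨a, ⟨b, c⟩⟩ ↦ (a - b) / (c + 1)`. -/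
def ratOfNat (k : ℕ) : ℚ :=
  ((k.unpair.1 : ℚ) - (k.unpair.2.unpair.1 : ℚ)) / ((k.unpair.2.unpair.2 : ℚ) + 1)

/-- The program `c` is a constructive real with value `x`: on every input `n` it halts with a
rational number at distance at most `2 ^ (-n)` from `x`. -/
def Names (c : Nat.Partrec.Code) (x : ℝ) : Prop :=
  ∀ n : ℕ, ∃ m ∈ c.eval n, |((ratOfNat m : ℚ) : ℝ) - x| ≤ ((2 : ℝ) ^ n)⁻¹

/-- Constructive (computable) real numbers. -/
def IsConstructiveReal (x : ℝ) : Prop := ∃ c : Nat.Partrec.Code, Names c x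

/-- The constructive points of the segment `[0,1]`. -/
abbrev ConstructivePoint : Type := {x : ℝ // x ∈ Icc (0 : ℝ) 1 ∧ IsConstructiveReal x}

/-- `f` is a constructive function `[0,1] → ℝ`: one algorithm turns every program for a point `x`
into a program for the value `f x`. -/
def IsConstructiveFunction (f : ConstructivePoint → ℝ) : Prop :=
  ∃ F : Nat.Partrec.Code →. Nat.Partrec.Code, Partrec F ∧
    ∀ (x : ConstructivePoint) (c : Nat.Partrec.Code), Names c (x : ℝ) →
      ∃ d ∈ F c, Names d (f x)

/-- Algorithmic sequences of rational numbers. -/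
def IsConstructiveRatSeq (q : ℕ → ℚ) : Prop :=
  ∃ t : ℕ → ℕ, Computable t ∧ ∀ n, ratOfNat (t n) = q n

/-! ### The constructive Riemann integral -/

/-- Integral partitions `0 = p₀ ≤ ξ₀ ≤ p₁ ≤ … ≤ pₙ = 1` of `[0,1]` with constructive points. -/
structure TaggedPartition where
  n : ℕ
  pt : Fin (n + 1) → ConstructivePoint
  tag : Fin n → ConstructivePoint
  pt_first : (pt 0 : ℝ) = 0
  pt_last : (pt (Fin.last n) : ℝ) = 1
  pt_le_tag : ∀ i : Fin n, (pt i.castSucc : ℝ) ≤ (tag i : ℝ)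
  tag_le_pt : ∀ i : Fin n, (tag i : ℝ) ≤ (pt i.succ : ℝ)

/-- All segments of the partition have length at most `d`. -/
def TaggedPartition.MeshLE (τ : TaggedPartition) (d : ℝ) : Prop :=
  ∀ i : Fin τ.n, (τ.pt i.succ : ℝ) - (τ.pt i.castSucc : ℝ) ≤ d

/-- The integral sum of `f` for the partition `τ`. -/
noncomputable def TaggedPartition.riemannSum (τ : TaggedPartition)
    (f : ConstructivePoint → ℝ) : ℝ :=
  ∑ i : Fin τ.n, f (τ.tag i) * ((τ.pt i.succ : ℝ) - (τ.pt i.castSucc : ℝ))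

/-- Constructive Riemann integrability: there are a constructive real `I` and an algorithmic
regulator `r` such that partitions of mesh at most `2 ^ (-r k)` have integral sums within
`2 ^ (-k)` of `I`. -/
def ConstructivelyRiemannIntegrable (f : ConstructivePoint → ℝ) : Prop :=
  ∃ I : ℝ, IsConstructiveReal I ∧ ∃ r : ℕ → ℕ, Computable r ∧
    ∀ (k : ℕ) (τ : TaggedPartition), τ.MeshLE ((2 : ℝ) ^ r k)⁻¹ →
      |τ.riemannSum f - I| < ((2 : ℝ) ^ k)⁻¹

/-! ### Polygonal functions -/

/-- A polygonal function on `[0,1]`, given by the list of its rational vertices `(pₖ, qₖ)` with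
`0 = p₀ < p₁ < … < pₘ = 1`. -/
structure Polygonal where
  nodes : List (ℚ × ℚ)
  increasing : (nodes.map Prod.fst).Pairwise (· < ·)
  first : (nodes.map Prod.fst).head? = some 0
  last : (nodes.map Prod.fst).getLast? = some 1

/-- Piecewise linear interpolation through a list of vertices with increasing abscissae. -/
noncomputable def interpolate : List (ℚ × ℚ) → ℝ → ℝ
  | [], _ => 0
  | [v], _ => (v.2 : ℝ)
  | v :: w :: L, x =>
      if x ≤ (w.1 : ℝ) then
        ((w.2 : ℝ) * (x - (v.1 : ℝ)) + (v.2 : ℝ) * ((w.1 : ℝ) - x)) / ((w.1 : ℝ) - (v.1 : ℝ))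
      else interpolate (w :: L) x

/-- The sum of the trapezoid areas `(qₖ + qₖ₋₁) (pₖ - pₖ₋₁) / 2`. -/
def trapezoidSum : List (ℚ × ℚ) → ℚ
  | [] => 0
  | [_] => 0
  | v :: w :: L => (w.2 + v.2) * (w.1 - v.1) / 2 + trapezoidSum (w :: L)

namespace Polygonal

/-- The value of a polygonal function at a point of `[0,1]`. -/
noncomputable def eval (g : Polygonal) (x : ℝ) : ℝ := interpolate g.nodes x

/-- The polygonal integral over `[0,1]`. -/
def integral (g : Polygonal) : ℚ := trapezoidSum g.nodes

/-- Non-negativity on `[0,1]`. -/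
def Nonneg (g : Polygonal) : Prop := ∀ x : ConstructivePoint, 0 ≤ g.eval x

end Polygonal

/-- Algorithmic sequences of polygonal functions (that is, of lists of vertices). -/
def IsConstructivePolygonalSeq (h : ℕ → Polygonal) : Prop :=
  ∃ t : ℕ → List (ℕ × ℕ), Computable t ∧
    ∀ n, (t n).map (Prod.map ratOfNat ratOfNat) = (h n).nodes

/-- A non-decreasing algorithmic sequence of non-negative polygonal functions with integrals
less than `1/2` that converges to `2` at every constructive point of `[0,1]`. -/
structure IsSingularSequence (h : ℕ → Polygonal) : Prop where
  constructive : IsConstructivePolygonalSeq h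
  nonneg : ∀ n, (h n).Nonneg
  mono : ∀ (n : ℕ) (x : ConstructivePoint), (h n).eval x ≤ (h (n + 1)).eval x
  limit : ∀ x : ConstructivePoint, Tendsto (fun n => (h n).eval x) atTop (𝓝 2)
  integral_lt : ∀ n, (h n).integral < 1 / 2

/-- The oscillation `ω(f, ε)`: the supremum of `|f t - f s|` over `t, s` in
`[x - ε, x + ε] ∩ [0,1]`. -/
noncomputable def oscillationOn (f : ℝ → ℝ) (ε : ℝ) (x : ℝ) : ℝ :=
  sSup {y : ℝ | ∃ t ∈ Icc (x - ε) (x + ε) ∩ Icc (0 : ℝ) 1,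
    ∃ s ∈ Icc (x - ε) (x + ε) ∩ Icc (0 : ℝ) 1, y = |f t - f s|}

/-- The tent function `x ↦ 2 ^ (-m) * max (0, 1 - |x - ζ| / β)`. -/
noncomputable def tent (m : ℕ) (ζ β : ℚ) (x : ℝ) : ℝ :=
  ((2 : ℝ) ^ m)⁻¹ * max 0 (1 - |x - (ζ : ℝ)| / (β : ℝ))

/-! ### Normal algorithms -/

/-- Words in the six-letter alphabet `{|, -, /, *, a, b}`. -/
abbrev Word : Type := List (Fin 6)

/-- The letter `|`. -/
def letterBar : Fin 6 := 0
/-- The letter `-`. -/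
def letterMinus : Fin 6 := 1
/-- The letter `/`. -/
def letterSlash : Fin 6 := 2
/-- The letter `*`. -/
def letterStar : Fin 6 := 3

/-- The scheme of a Markov normal algorithm: the list of its substitution formulas `(P, Q, t)`,
where `t = true` marks a terminal formula `P → · Q` and `t = false` a simple one `P → Q`. -/
abbrev NormalAlgorithm : Type := List (Word × Word × Bool)

/-- Replace the leftmost occurrence of `P` by `Q` (`none` if `P` does not occur). -/
def substLeftmost (P Q : Word) : Word → Option Word
  | [] => if P = [] then some Q else none
  | c :: W =>
      if P.isPrefixOf (c :: W) then some (Q ++ (c :: W).drop P.length)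
      else (substLeftmost P Q W).map (c :: ·)

/-- Apply the first applicable formula; the Boolean tells whether it is terminal. -/
def NormalAlgorithm.step : NormalAlgorithm → Word → Option (Word × Bool)
  | [], _ => none
  | (P, Q, t) :: S, W =>
      match substLeftmost P Q W with
      | some V => some (V, t)
      | none => NormalAlgorithm.step S W

/-- `S.Yields W V`: the process of applying `S` to the word `W` stops with the result `V`. -/
inductive NormalAlgorithm.Yields (S : NormalAlgorithm) : Word → Word → Prop
  | stuck {W : Word} : NormalAlgorithm.step S W = none → NormalAlgorithm.Yields S W W
  | terminal {W V : Word} : NormalAlgorithm.step S W = some (V, true) →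
      NormalAlgorithm.Yields S W V
  | next {W V U : Word} : NormalAlgorithm.step S W = some (V, false) →
      NormalAlgorithm.Yields S V U → NormalAlgorithm.Yields S W U

/-- The natural number `n` as a word `|…|`. -/
def natWord (n : ℕ) : Word := List.replicate n letterBar

/-- The integer notations `|…|` and `-|…|`. -/
inductive IsIntWord : Word → ℤ → Prop
  | nonneg (a : ℕ) : IsIntWord (natWord a) a
  | neg (a : ℕ) : 0 < a → IsIntWord (letterMinus :: natWord a) (-a)

/-- The rational notations: an integer `z`, or a fraction `z/b` with `b` a positive integer. -/
inductive IsRatWord : Word → ℚ → Prop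
  | int {w : Word} {z : ℤ} : IsIntWord w z → IsRatWord w z
  | frac {w : Word} {z : ℤ} (b : ℕ) : IsIntWord w z → 0 < b →
      IsRatWord (w ++ letterSlash :: natWord b) ((z : ℚ) / (b : ℚ))

/-- The star system `*P₁*P₂*…*Pₖ*`. -/
def starSystem (ws : List Word) : Word :=
  letterStar :: ws.flatMap (fun w => w ++ [letterStar])

/-- `W` has the form `*δ*p₀*q₀*…*pₘ*qₘ*`, where `(pₖ, qₖ)` are the vertices of `g`. -/
def IsOutputWord (W : Word) (δ : ℚ) (g : Polygonal) : Prop :=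
  ∃ ws : List Word, W = starSystem ws ∧
    List.Forall₂ IsRatWord ws (δ :: g.nodes.flatMap (fun v => [v.1, v.2]))

/-- A numbering of all normal algorithms in the six-letter alphabet. -/
def IsNumbering (A : ℕ → NormalAlgorithm) : Prop := Computable A ∧ Function.Surjective A

/-- The algorithm number `N`, applied to its own number `N`, stops and produces a positive rational
`δ` and a non-negative polygonal function `g` with integral less than `1/2`. -/
def DiagonalOutput (A : ℕ → NormalAlgorithm) (N : ℕ) (δ : ℚ) (g : Polygonal) : Prop :=
  (∃ W : Word, NormalAlgorithm.Yields (A N) (natWord N) W ∧ IsOutputWord W δ g) ∧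
    0 < δ ∧ g.Nonneg ∧ g.integral < 1 / 2

/-- The set of indices `N` that are listed by the diagonal enumeration. -/
def diagonalSet (A : ℕ → NormalAlgorithm) : Set ℕ :=
  {N | ∃ (δ : ℚ) (g : Polygonal), DiagonalOutput A N δ g}

/-- `μ` is a total algorithm that enumerates the diagonal set without repetitions. -/
structure IsDiagonalEnumeration (A : ℕ → NormalAlgorithm) (μ : ℕ → ℕ) : Prop where
  computable : Computable μ
  injective : Function.Injective μ
  range_eq : Set.range μ = diagonalSet A

/-! Pointwise finiteness. As `h n` tends to `2` at a constructive point `x`, some `n` has `1 < h n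
x`, and a search through rational approximations of `x` finds one. For `k ≥ n` monotonicity gives `h
(ν k) x > 1`, because `ν k ≥ k`. On the support of the `k`-th tent, however, `g k + h (ν k) < 1`
with `g k ≥ 0`, so `x` is off that support and the term vanishes (`exists_partrec_index`, and
`hzero` in the main proof). The sum near `x` is then a finite sum of explicit Lipschitz functions,
so its value is computable from a program for `x`.

Oscillation. Within radius `η`, a tent of height `2 ^ (-m)` and half-width `β` oscillates only on an
interval of length `2 (β + η)`, by at most `2 ^ (-m) * min 1 (2 η / β)`. The area of this rectangle
is at most `8 η * 2 ^ (-m)`, whatever `β` is (`window_area_le`). Since `μ` is injective, the weights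
`2 ^ (-μ k)` add up to less than `2`, and every finite sum has oscillation integral below `16 η`.

Integrability. An integral sum of mesh `d` of a Lipschitz function misses the integral by at most
the integral of the oscillation at radius `d`, hence by at most `16 d` for every partial sum. A
partition has finitely many tags, so at the tags `f` equals all late partial sums, and the bound
passes to the limit `I`, the sum of the integrals of the tents. That series comes with no rate of
convergence, so `I` is computed instead from integral sums of `f` over dyadic partitions, which are
exact rational numbers once one index `n` with `h n > 1` at all tags is found. -/

open MeasureTheory

/-! ### Computable rational-valued functions -/

section RatCodes

variable {α β : Type*} [Primcodable α] [Primcodable β]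

/-- `φ` is computed by a primitive recursive function into the codes of rational numbers. -/
def RatPrimrec (φ : α → ℚ) : Prop := ∃ t : α → ℕ, Primrec t ∧ ∀ a, ratOfNat (t a) = φ a

/-- `φ` is computed by a computable function into the codes of rational numbers. -/
def RatComputable (φ : α → ℚ) : Prop := ∃ t : α → ℕ, Computable t ∧ ∀ a, ratOfNat (t a) = φ a

/-- The code of `(a - b) / (c + 1)`. -/
def ratCode (a b c : ℕ) : ℕ := Nat.pair a (Nat.pair b c)

theorem ratOfNat_ratCode (a b c : ℕ) : ratOfNat (ratCode a b c) = ((a : ℚ) - b) / (c + 1) := by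
  simp [ratOfNat, ratCode]

theorem ratOfNat_eq_ratCode (k : ℕ) :
    ∃ a b c : ℕ, k.unpair.1 = a ∧ k.unpair.2.unpair.1 = b ∧ k.unpair.2.unpair.2 = c ∧
      ratOfNat k = ((a : ℚ) - b) / (c + 1) :=
  ⟨_, _, _, rfl, rfl, rfl, rfl⟩

theorem primrec_ratCode {f g h : α → ℕ} (hf : Primrec f) (hg : Primrec g) (hh : Primrec h) :
    Primrec fun a => ratCode (f a) (g a) (h a) :=
  Primrec₂.natPair.comp hf (Primrec₂.natPair.comp hg hh)

theorem Primrec.unpair_fst {f : α → ℕ} (hf : Primrec f) : Primrec fun a => (f a).unpair.1 :=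
  Primrec.fst.comp (Primrec.unpair.comp hf)

theorem Primrec.unpair_snd {f : α → ℕ} (hf : Primrec f) : Primrec fun a => (f a).unpair.2 :=
  Primrec.snd.comp (Primrec.unpair.comp hf)

theorem RatPrimrec.ratComputable {φ : α → ℚ} (h : RatPrimrec φ) : RatComputable φ :=
  let ⟨t, ht, e⟩ := h
  ⟨t, ht.to_comp, e⟩

theorem RatPrimrec.of_eq {φ ψ : α → ℚ} (h : RatPrimrec φ) (e : ∀ a, φ a = ψ a) :
    RatPrimrec ψ := (funext e : φ = ψ) ▸ h

theorem RatComputable.of_eq {φ ψ : α → ℚ} (h : RatComputable φ) (e : ∀ a, φ a = ψ a) :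
    RatComputable ψ := (funext e : φ = ψ) ▸ h

theorem RatPrimrec.comp {φ : β → ℚ} {f : α → β} (h : RatPrimrec φ) (hf : Primrec f) :
    RatPrimrec fun a => φ (f a) :=
  let ⟨t, ht, e⟩ := h
  ⟨fun a => t (f a), ht.comp hf, fun a => e (f a)⟩

theorem RatComputable.comp {φ : β → ℚ} {f : α → β} (h : RatComputable φ) (hf : Computable f) :
    RatComputable fun a => φ (f a) :=
  let ⟨t, ht, e⟩ := h
  ⟨fun a => t (f a), ht.comp hf, fun a => e (f a)⟩

theorem ratPrimrec_ratOfNat {f : α → ℕ} (hf : Primrec f) :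
    RatPrimrec fun a => ratOfNat (f a) := ⟨f, hf, fun _ => rfl⟩

theorem ratComputable_ratOfNat {f : α → ℕ} (hf : Computable f) :
    RatComputable fun a => ratOfNat (f a) := ⟨f, hf, fun _ => rfl⟩

/-- A value computed by `φ` may be fed into a function computed from codes. -/
theorem RatComputable.subst {ψ : β → ℚ → ℚ}
    (h : RatComputable fun p : β × ℕ => ψ p.1 (ratOfNat p.2))
    {f : α → β} (hf : Computable f) {φ : α → ℚ} (hφ : RatComputable φ) :
    RatComputable fun a => ψ (f a) (φ a) := by
  obtain ⟨t, ht, e⟩ := hφ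
  exact (h.comp (hf.pair ht)).of_eq fun a => by simp [e]

theorem RatPrimrec.subst₂ {Φ : ℚ → ℚ → ℚ}
    (h : RatPrimrec fun p : ℕ × ℕ => Φ (ratOfNat p.1) (ratOfNat p.2))
    {φ ψ : α → ℚ} (hφ : RatPrimrec φ) (hψ : RatPrimrec ψ) :
    RatPrimrec fun a => Φ (φ a) (ψ a) := by
  obtain ⟨t, ht, e⟩ := hφ
  obtain ⟨u, hu, e'⟩ := hψ
  exact (h.comp (ht.pair hu)).of_eq fun a => by simp [e, e']

theorem RatComputable.subst₂ {Φ : ℚ → ℚ → ℚ}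
    (h : RatPrimrec fun p : ℕ × ℕ => Φ (ratOfNat p.1) (ratOfNat p.2))
    {φ ψ : α → ℚ} (hφ : RatComputable φ) (hψ : RatComputable ψ) :
    RatComputable fun a => Φ (φ a) (ψ a) := by
  obtain ⟨t, ht, e⟩ := hφ
  obtain ⟨u, hu, e'⟩ := hψ
  exact (h.ratComputable.comp (ht.pair hu)).of_eq fun a => by simp [e, e']

theorem ratPrimrec_natCast_div {f g : α → ℕ} (hf : Primrec f) (hg : Primrec g) :
    RatPrimrec fun a => (f a : ℚ) / (g a + 1) :=
  ⟨fun a => ratCode (f a) 0 (g a), primrec_ratCode hf (.const 0) hg, fun a => by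
    simp [ratOfNat_ratCode]⟩

theorem ratPrimrec_natCast {f : α → ℕ} (hf : Primrec f) : RatPrimrec fun a => (f a : ℚ) :=
  (ratPrimrec_natCast_div hf (.const 0)).of_eq fun a => by simp

theorem ratPrimrec_zero : RatPrimrec fun _ : α => (0 : ℚ) :=
  (ratPrimrec_natCast (.const 0)).of_eq fun _ => by simp

theorem ratPrimrec_one : RatPrimrec fun _ : α => (1 : ℚ) :=
  (ratPrimrec_natCast (.const 1)).of_eq fun _ => by simp

theorem Primrec.two_pow : Primrec fun n : ℕ => 2 ^ n :=
  (Primrec.nat_rec₁ 1 (Primrec.nat_mul.comp (.const 2) .snd).to₂).of_eq fun n => by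
    induction n with
    | zero => rfl
    | succ n ih => exact (congrArg (2 * ·) ih).trans (pow_succ' 2 n).symm

theorem ratPrimrec_inv_two_pow : RatPrimrec fun n : ℕ => ((2 : ℚ) ^ n)⁻¹ :=
  -- Codes store the denominator less one, whence the predecessor.
  (ratPrimrec_natCast_div (.const 1) (Primrec.pred.comp Primrec.two_pow)).of_eq fun n => by
    have : 1 ≤ 2 ^ n := Nat.one_le_two_pow
    simp [Nat.cast_sub this]

theorem ratPrimrec_add :
    RatPrimrec fun p : ℕ × ℕ => ratOfNat p.1 + ratOfNat p.2 := by
  let a (k : ℕ) := k.unpair.1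
  let b (k : ℕ) := k.unpair.2.unpair.1
  let c (k : ℕ) := k.unpair.2.unpair.2
  have ha : Primrec a := Primrec.id.unpair_fst
  have hb : Primrec b := Primrec.id.unpair_snd.unpair_fst
  have hc : Primrec c := Primrec.id.unpair_snd.unpair_snd
  have h1 := Primrec.fst (α := ℕ) (β := ℕ)
  have h2 := Primrec.snd (α := ℕ) (β := ℕ)
  -- The last entry is `(c p.1 + 1) * (c p.2 + 1) - 1`, written without subtraction.
  refine ⟨fun p => ratCode (a p.1 * (c p.2 + 1) + a p.2 * (c p.1 + 1))
    (b p.1 * (c p.2 + 1) + b p.2 * (c p.1 + 1)) (c p.1 * c p.2 + c p.1 + c p.2),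
    primrec_ratCode
      (Primrec.nat_add.comp
        (Primrec.nat_mul.comp (ha.comp h1) (Primrec.succ.comp (hc.comp h2)))
        (Primrec.nat_mul.comp (ha.comp h2) (Primrec.succ.comp (hc.comp h1))))
      (Primrec.nat_add.comp
        (Primrec.nat_mul.comp (hb.comp h1) (Primrec.succ.comp (hc.comp h2)))
        (Primrec.nat_mul.comp (hb.comp h2) (Primrec.succ.comp (hc.comp h1))))
      (Primrec.nat_add.comp (Primrec.nat_add.comp
        (Primrec.nat_mul.comp (hc.comp h1) (hc.comp h2)) (hc.comp h1)) (hc.comp h2)), ?_⟩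
  rintro ⟨j, k⟩
  rw [ratOfNat_ratCode]
  change _ = ((a j : ℚ) - b j) / (c j + 1) + ((a k : ℚ) - b k) / (c k + 1)
  have hj : (c j : ℚ) + 1 ≠ 0 := by positivity
  have hk : (c k : ℚ) + 1 ≠ 0 := by positivity
  have hjk : (c j : ℚ) * c k + c j + c k + 1 ≠ 0 := by positivity
  push_cast
  field_simp
  ring

theorem ratPrimrec_mul :
    RatPrimrec fun p : ℕ × ℕ => ratOfNat p.1 * ratOfNat p.2 := by
  let a (k : ℕ) := k.unpair.1
  let b (k : ℕ) := k.unpair.2.unpair.1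
  let c (k : ℕ) := k.unpair.2.unpair.2
  have ha : Primrec a := Primrec.id.unpair_fst
  have hb : Primrec b := Primrec.id.unpair_snd.unpair_fst
  have hc : Primrec c := Primrec.id.unpair_snd.unpair_snd
  have h1 := Primrec.fst (α := ℕ) (β := ℕ)
  have h2 := Primrec.snd (α := ℕ) (β := ℕ)
  refine ⟨fun p => ratCode (a p.1 * a p.2 + b p.1 * b p.2)
    (a p.1 * b p.2 + b p.1 * a p.2) (c p.1 * c p.2 + c p.1 + c p.2),
    primrec_ratCode
      (Primrec.nat_add.comp
        (Primrec.nat_mul.comp (ha.comp h1) (ha.comp h2))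
        (Primrec.nat_mul.comp (hb.comp h1) (hb.comp h2)))
      (Primrec.nat_add.comp
        (Primrec.nat_mul.comp (ha.comp h1) (hb.comp h2))
        (Primrec.nat_mul.comp (hb.comp h1) (ha.comp h2)))
      (Primrec.nat_add.comp (Primrec.nat_add.comp
        (Primrec.nat_mul.comp (hc.comp h1) (hc.comp h2)) (hc.comp h1)) (hc.comp h2)), ?_⟩
  rintro ⟨j, k⟩
  rw [ratOfNat_ratCode]
  change _ = ((a j : ℚ) - b j) / (c j + 1) * (((a k : ℚ) - b k) / (c k + 1))
  have hj : (c j : ℚ) + 1 ≠ 0 := by positivity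
  have hk : (c k : ℚ) + 1 ≠ 0 := by positivity
  have hjk : (c j : ℚ) * c k + c j + c k + 1 ≠ 0 := by positivity
  push_cast
  field_simp
  ring

theorem ratPrimrec_neg : RatPrimrec fun k : ℕ => -ratOfNat k :=
  ⟨fun k => ratCode k.unpair.2.unpair.1 k.unpair.1 k.unpair.2.unpair.2,
    primrec_ratCode Primrec.id.unpair_snd.unpair_fst Primrec.id.unpair_fst
      Primrec.id.unpair_snd.unpair_snd, fun k => by
    dsimp only
    rw [ratOfNat_ratCode]
    simp only [ratOfNat, ← neg_div, neg_sub]⟩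

theorem ratPrimrec_inv : RatPrimrec fun k : ℕ => (ratOfNat k)⁻¹ := by
  have ha : Primrec fun k : ℕ => k.unpair.1 := Primrec.id.unpair_fst
  have hb : Primrec fun k : ℕ => k.unpair.2.unpair.1 := Primrec.id.unpair_snd.unpair_fst
  have hc : Primrec fun k : ℕ => k.unpair.2.unpair.2 + 1 :=
    Primrec.succ.comp Primrec.id.unpair_snd.unpair_snd
  refine ⟨fun k =>
    -- Comparing the two parts of the numerator gives its sign, so the truncated subtractions are
    -- exact; the final `- 1` is the shift of the stored denominator. The last branch is `0⁻¹ = 0`.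
    if k.unpair.2.unpair.1 < k.unpair.1 then
      ratCode (k.unpair.2.unpair.2 + 1) 0 (k.unpair.1 - k.unpair.2.unpair.1 - 1)
    else if k.unpair.1 < k.unpair.2.unpair.1 then
      ratCode 0 (k.unpair.2.unpair.2 + 1) (k.unpair.2.unpair.1 - k.unpair.1 - 1)
    else ratCode 0 0 0,
    Primrec.ite (Primrec.nat_lt.comp hb ha)
      (primrec_ratCode hc (.const 0) (Primrec.nat_sub.comp (Primrec.nat_sub.comp ha hb) (.const 1)))
      (Primrec.ite (Primrec.nat_lt.comp ha hb)
        (primrec_ratCode (.const 0) hc (Primrec.nat_sub.comp (Primrec.nat_sub.comp hb ha) (.const 1)))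
        (.const _)), fun k => ?_⟩
  obtain ⟨a, b, c, e1, e2, e3, e⟩ := ratOfNat_eq_ratCode k
  simp only [e1, e2, e3, e]
  split_ifs with h1 h2
  · rw [ratOfNat_ratCode, Nat.sub_sub, Nat.cast_sub (by omega)]
    push_cast
    rw [inv_div, sub_zero]
    congr 1
    ring
  · rw [ratOfNat_ratCode, Nat.sub_sub, Nat.cast_sub (by omega)]
    push_cast
    rw [inv_div, zero_sub, ← neg_sub (b : ℚ) a, div_neg, neg_div]
    congr 2
    ring
  · have : a = b := by omega
    simp [ratOfNat_ratCode, this]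

theorem RatPrimrec.neg {φ : α → ℚ} (h : RatPrimrec φ) : RatPrimrec fun a => -φ a := by
  obtain ⟨t, ht, e⟩ := h
  exact (ratPrimrec_neg.comp ht).of_eq fun a => by simp [e]

theorem RatPrimrec.inv {φ : α → ℚ} (h : RatPrimrec φ) : RatPrimrec fun a => (φ a)⁻¹ := by
  obtain ⟨t, ht, e⟩ := h
  exact (ratPrimrec_inv.comp ht).of_eq fun a => by simp [e]

theorem RatPrimrec.add {φ ψ : α → ℚ} (h : RatPrimrec φ) (h' : RatPrimrec ψ) :
    RatPrimrec fun a => φ a + ψ a := ratPrimrec_add.subst₂ h h'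

theorem RatPrimrec.mul {φ ψ : α → ℚ} (h : RatPrimrec φ) (h' : RatPrimrec ψ) :
    RatPrimrec fun a => φ a * ψ a := ratPrimrec_mul.subst₂ h h'

theorem RatPrimrec.sub {φ ψ : α → ℚ} (h : RatPrimrec φ) (h' : RatPrimrec ψ) :
    RatPrimrec fun a => φ a - ψ a :=
  (h.add h'.neg).of_eq fun _ => (sub_eq_add_neg _ _).symm

theorem RatPrimrec.div {φ ψ : α → ℚ} (h : RatPrimrec φ) (h' : RatPrimrec ψ) :
    RatPrimrec fun a => φ a / ψ a :=
  (h.mul h'.inv).of_eq fun _ => (div_eq_mul_inv _ _).symm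

theorem RatPrimrec.nonneg {φ : α → ℚ} (h : RatPrimrec φ) : PrimrecPred fun a => 0 ≤ φ a := by
  obtain ⟨t, ht, e⟩ := h
  refine (Primrec.nat_le.comp ht.unpair_snd.unpair_fst ht.unpair_fst).of_eq fun a => ?_
  rw [← e, ratOfNat, le_div_iff₀ (by positivity), zero_mul, sub_nonneg, Nat.cast_le]

theorem RatPrimrec.le {φ ψ : α → ℚ} (h : RatPrimrec φ) (h' : RatPrimrec ψ) :
    PrimrecPred fun a => φ a ≤ ψ a :=
  (h'.sub h).nonneg.of_eq fun _ => sub_nonneg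

theorem RatPrimrec.ite {c : α → Prop} [DecidablePred c] {φ ψ : α → ℚ} (hc : PrimrecPred c)
    (h : RatPrimrec φ) (h' : RatPrimrec ψ) : RatPrimrec fun a => if c a then φ a else ψ a := by
  obtain ⟨t, ht, e⟩ := h
  obtain ⟨u, hu, e'⟩ := h'
  exact ⟨fun a => if c a then t a else u a, Primrec.ite hc ht hu, fun a => by
    dsimp only; split_ifs <;> simp [e, e']⟩

theorem RatPrimrec.max {φ ψ : α → ℚ} (h : RatPrimrec φ) (h' : RatPrimrec ψ) :
    RatPrimrec fun a => max (φ a) (ψ a) :=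
  (RatPrimrec.ite (h.le h') h' h).of_eq fun _ => (max_def _ _).symm

theorem RatPrimrec.abs {φ : α → ℚ} (h : RatPrimrec φ) : RatPrimrec fun a => |φ a| :=
  h.max h.neg

theorem ratPrimrec_fst : RatPrimrec fun p : ℕ × ℕ => ratOfNat p.1 := ratPrimrec_ratOfNat .fst

theorem ratPrimrec_snd : RatPrimrec fun p : ℕ × ℕ => ratOfNat p.2 := ratPrimrec_ratOfNat .snd

theorem RatComputable.add {φ ψ : α → ℚ} (h : RatComputable φ) (h' : RatComputable ψ) :
    RatComputable fun a => φ a + ψ a := RatComputable.subst₂ ratPrimrec_add h h'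

theorem RatComputable.mul {φ ψ : α → ℚ} (h : RatComputable φ) (h' : RatComputable ψ) :
    RatComputable fun a => φ a * ψ a := RatComputable.subst₂ ratPrimrec_mul h h'

theorem RatComputable.sub {φ ψ : α → ℚ} (h : RatComputable φ) (h' : RatComputable ψ) :
    RatComputable fun a => φ a - ψ a := RatComputable.subst₂ (ratPrimrec_fst.sub ratPrimrec_snd) h h'

theorem RatComputable.div {φ ψ : α → ℚ} (h : RatComputable φ) (h' : RatComputable ψ) :
    RatComputable fun a => φ a / ψ a := RatComputable.subst₂ (ratPrimrec_fst.div ratPrimrec_snd) h h'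

theorem RatComputable.max {φ ψ : α → ℚ} (h : RatComputable φ) (h' : RatComputable ψ) :
    RatComputable fun a => max (φ a) (ψ a) := RatComputable.subst₂ (ratPrimrec_fst.max ratPrimrec_snd) h h'

theorem RatComputable.abs {φ : α → ℚ} (h : RatComputable φ) : RatComputable fun a => |φ a| :=
  RatComputable.subst₂ (Φ := fun x _ => |x|) ratPrimrec_fst.abs h h

theorem RatComputable.inv_two_pow {f : α → ℕ} (hf : Computable f) :
    RatComputable fun a => ((2 : ℚ) ^ f a)⁻¹ := ratPrimrec_inv_two_pow.ratComputable.comp hf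

theorem RatComputable.decide_lt {φ ψ : α → ℚ} (h : RatComputable φ) (h' : RatComputable ψ) :
    Computable fun a => decide (φ a < ψ a) := by
  obtain ⟨t, ht, e⟩ := h
  obtain ⟨u, hu, e'⟩ := h'
  have : PrimrecPred fun p : ℕ × ℕ => ratOfNat p.1 < ratOfNat p.2 :=
    (ratPrimrec_snd.le ratPrimrec_fst).not.of_eq fun _ => not_le
  exact (this.decide.to_comp.comp (ht.pair hu)).of_eq fun a => by simp [e, e']

theorem RatComputable.sum_range {φ : α × ℕ → ℚ} (h : RatComputable φ) {N : α → ℕ}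
    (hN : Computable N) : RatComputable fun a => ∑ i ∈ Finset.range (N a), φ (a, i) := by
  obtain ⟨t, ht, e⟩ := h
  obtain ⟨u, hu, e'⟩ := ratPrimrec_add
  obtain ⟨z, -, ez⟩ := ratPrimrec_zero (α := ℕ)
  refine ⟨_, Computable.nat_rec (h := fun a (q : ℕ × ℕ) => u (q.2, t (a, q.1))) hN
    (Computable.const (z 0)) (hu.to_comp.comp ((Computable.snd.comp .snd).pair
      (ht.comp (Computable.fst.pair (Computable.fst.comp .snd))))), fun a => ?_⟩
  dsimp only
  induction N a with
  | zero => simp [ez]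
  | succ n ih => rw [Finset.sum_range_succ, ← ih]; simp [e, e']

end RatCodes

/-! ### Polygonal functions at rational points -/

/-- The recursion runs on codes. A rational has many codes, so the step `s` is required to be
computable from an arbitrary code of the preceding value. -/
theorem RatPrimrec.list_rec {α β : Type*} [Primcodable α] [Primcodable β]
    {F : α → List β → ℚ} {s : α × β × List β → ℚ → ℚ}
    (h0 : RatPrimrec fun a => F a [])
    (hs : RatPrimrec fun p : (α × β × List β) × ℕ => s p.1 (ratOfNat p.2))
    (hF : ∀ a b l, F a (b :: l) = s (a, b, l) (F a l)) :
    RatPrimrec fun p : List β × α => F p.2 p.1 := by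
  obtain ⟨t, ht, e⟩ := h0
  obtain ⟨u, hu, e'⟩ := hs
  have hu' : Primrec₂ fun (p : List β × α) (q : β × List β × ℕ) =>
      u ((p.2, q.1, q.2.1), q.2.2) :=
    hu.comp (((Primrec.snd.comp .fst).pair ((Primrec.fst.comp .snd).pair
      (Primrec.fst.comp (Primrec.snd.comp .snd)))).pair
        (Primrec.snd.comp (Primrec.snd.comp .snd)))
  refine ⟨_, Primrec.list_rec Primrec.fst (ht.comp .snd) hu', ?_⟩
  rintro ⟨l, a⟩
  dsimp only
  induction l with
  | nil => exact e a
  | cons b l ih => rw [hF, ← ih]; exact e' _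

/-- Piecewise linear interpolation at rational points. -/
def interpolateRat : List (ℚ × ℚ) → ℚ → ℚ
  | [], _ => 0
  | [v], _ => v.2
  | v :: w :: L, x =>
      if x ≤ w.1 then (w.2 * (x - v.1) + v.2 * (w.1 - x)) / (w.1 - v.1)
      else interpolateRat (w :: L) x

/-- The sum of the absolute values of the slopes of a polygonal line. -/
def slopeSum : List (ℚ × ℚ) → ℚ
  | [] => 0
  | [_] => 0
  | v :: w :: L => |(w.2 - v.2) / (w.1 - v.1)| + slopeSum (w :: L)

theorem interpolate_ratCast (L : List (ℚ × ℚ)) (x : ℚ) :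
    interpolate L (x : ℝ) = (interpolateRat L x : ℝ) := by
  induction L with
  | nil => simp [interpolate, interpolateRat]
  | cons v L ih =>
    cases L with
    | nil => simp [interpolate, interpolateRat]
    | cons w L =>
      simp only [interpolate, interpolateRat, Rat.cast_le]
      split_ifs
      · push_cast; rfl
      · exact ih

theorem slopeSum_nonneg (L : List (ℚ × ℚ)) : 0 ≤ slopeSum L := by
  induction L with
  | nil => exact le_rfl
  | cons v L ih =>
    cases L with
    | nil => exact le_rfl
    | cons w L => exact add_nonneg (abs_nonneg _) ih

theorem interpolate_cons_fst {v w : ℚ × ℚ} {L : List (ℚ × ℚ)} (hvw : v.1 < w.1) {x : ℝ}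
    (hx : x ≤ w.1) :
    interpolate (v :: w :: L) x =
      w.2 - (((w.2 - v.2) / (w.1 - v.1) : ℚ) : ℝ) * (w.1 - x) := by
  have : (w.1 : ℝ) - v.1 ≠ 0 := by
    rw [sub_ne_zero]; exact_mod_cast hvw.ne'
  rw [interpolate, if_pos hx]
  push_cast
  field_simp
  ring

theorem interpolate_head {v : ℚ × ℚ} {L : List (ℚ × ℚ)}
    (h : ((v :: L).map Prod.fst).Pairwise (· < ·)) : interpolate (v :: L) v.1 = v.2 := by
  cases L with
  | nil => rfl
  | cons w L =>
    have hvw : v.1 < w.1 := by simp at h; exact h.1.1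
    have : (w.1 : ℝ) - v.1 ≠ 0 := by
      rw [sub_ne_zero]; exact_mod_cast hvw.ne'
    rw [interpolate_cons_fst hvw (by exact_mod_cast hvw.le)]
    push_cast
    field_simp
    ring

/-- Induction, splitting `[x, y]` at the second vertex when it lies inside. The sum of slopes is a
crude Lipschitz constant, but it is computable by recursion. The estimate holds on the whole line,
as rational approximations of a point of `[0,1]` may fall outside. -/
theorem abs_interpolate_sub_le_of_le {L : List (ℚ × ℚ)}
    (h : (L.map Prod.fst).Pairwise (· < ·)) {x y : ℝ} (hxy : x ≤ y) :
    |interpolate L x - interpolate L y| ≤ slopeSum L * (y - x) := by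
  induction L generalizing x y with
  | nil => simp [interpolate, slopeSum]
  | cons v L ih =>
    cases L with
    | nil => simp [interpolate, slopeSum]
    | cons w L =>
      have hvw : v.1 < w.1 := by simp at h; exact h.1.1
      have hw : ((w :: L).map Prod.fst).Pairwise (· < ·) := by
        rw [List.map_cons, List.pairwise_cons] at h
        exact h.2
      set m : ℚ := (w.2 - v.2) / (w.1 - v.1) with hm
      have hs : (slopeSum (v :: w :: L) : ℝ) = |(m : ℝ)| + slopeSum (w :: L) := by
        simp only [slopeSum]; push_cast; rw [hm]; push_cast; rfl
      have hs0 : (0 : ℝ) ≤ slopeSum (w :: L) := by exact_mod_cast slopeSum_nonneg _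
      rw [hs, add_mul]
      rcases le_or_gt y w.1 with hy | hy
      · rw [interpolate_cons_fst hvw (hxy.trans hy), interpolate_cons_fst hvw hy, ← hm]
        have : (w.2 : ℝ) - m * (w.1 - x) - (w.2 - m * (w.1 - y)) = m * -(y - x) := by ring
        rw [this, abs_mul, abs_neg, abs_of_nonneg (sub_nonneg.2 hxy)]
        exact le_add_of_nonneg_right (mul_nonneg hs0 (sub_nonneg.2 hxy))
      · have e : interpolate (v :: w :: L) y = interpolate (w :: L) y := by
          rw [interpolate, if_neg hy.not_ge]
        rcases le_or_gt x w.1 with hx | hx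
        · have h1 := ih hw hy.le
          rw [interpolate_head hw] at h1
          have h2 : |interpolate (v :: w :: L) x - w.2| = |(m : ℝ)| * (w.1 - x) := by
            rw [interpolate_cons_fst hvw hx, ← hm, sub_sub_cancel_left, abs_neg, abs_mul,
              abs_of_nonneg (sub_nonneg.2 hx)]
          rw [e]
          refine (abs_sub_le _ (w.2 : ℝ) _).trans (add_le_add ?_ (h1.trans ?_))
          · rw [h2]
            gcongr
          · gcongr
        · have e' : interpolate (v :: w :: L) x = interpolate (w :: L) x := by
            rw [interpolate, if_neg hx.not_ge]
          rw [e, e']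
          exact (ih hw hxy).trans
            (le_add_of_nonneg_left (mul_nonneg (abs_nonneg _) (sub_nonneg.2 hxy)))

theorem Polygonal.abs_eval_sub_le (g : Polygonal) (x y : ℝ) :
    |g.eval x - g.eval y| ≤ slopeSum g.nodes * |x - y| := by
  rcases le_total x y with hxy | hxy
  · rw [abs_sub_comm x y, abs_of_nonneg (sub_nonneg.2 hxy)]
    exact abs_interpolate_sub_le_of_le g.increasing hxy
  · rw [abs_of_nonneg (sub_nonneg.2 hxy), abs_sub_comm]
    exact abs_interpolate_sub_le_of_le g.increasing hxy

theorem ratPrimrec_interpolateRat :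
    RatPrimrec fun p : List (ℕ × ℕ) × ℕ =>
      interpolateRat (p.1.map (Prod.map ratOfNat ratOfNat)) (ratOfNat p.2) := by
  let T := (ℕ × (ℕ × ℕ) × List (ℕ × ℕ)) × ℕ
  have hx : RatPrimrec fun p : T => ratOfNat p.1.1 :=
    ratPrimrec_ratOfNat (Primrec.fst.comp .fst)
  have hv := Primrec.fst.comp (Primrec.snd.comp (Primrec.fst (α := ℕ × (ℕ × ℕ) × List (ℕ × ℕ))
    (β := ℕ)))
  have hl := Primrec.snd.comp (Primrec.snd.comp (Primrec.fst (α := ℕ × (ℕ × ℕ) × List (ℕ × ℕ))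
    (β := ℕ)))
  have hw := Primrec.list_headI.comp hl
  have hv1 := ratPrimrec_ratOfNat (Primrec.fst.comp hv)
  have hv2 := ratPrimrec_ratOfNat (Primrec.snd.comp hv)
  have hw1 := ratPrimrec_ratOfNat (Primrec.fst.comp hw)
  have hw2 := ratPrimrec_ratOfNat (Primrec.snd.comp hw)
  have hih : RatPrimrec fun p : T => ratOfNat p.2 := ratPrimrec_ratOfNat .snd
  refine RatPrimrec.list_rec
    (F := fun x l => interpolateRat (l.map (Prod.map ratOfNat ratOfNat)) (ratOfNat x))
    -- The length test separates the one-vertex case, so the default value of `headI` is never used.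
    (s := fun a ih => if a.2.2.length ≤ 0 then ratOfNat a.2.1.2 else
      if ratOfNat a.1 ≤ ratOfNat a.2.2.headI.1 then
        (ratOfNat a.2.2.headI.2 * (ratOfNat a.1 - ratOfNat a.2.1.1) +
          ratOfNat a.2.1.2 * (ratOfNat a.2.2.headI.1 - ratOfNat a.1)) /
            (ratOfNat a.2.2.headI.1 - ratOfNat a.2.1.1)
      else ih)
    (ratPrimrec_zero.of_eq fun _ => rfl)
    (RatPrimrec.ite (Primrec.nat_le.comp (Primrec.list_length.comp hl) (.const 0)) hv2
      (RatPrimrec.ite (hx.le hw1)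
        (((hw2.mul (hx.sub hv1)).add (hv2.mul (hw1.sub hx))).div (hw1.sub hv1)) hih)) ?_
  intro x v l
  cases l <;> simp [interpolateRat]

theorem ratPrimrec_slopeSum :
    RatPrimrec fun l : List (ℕ × ℕ) => slopeSum (l.map (Prod.map ratOfNat ratOfNat)) := by
  let T := (ℕ × (ℕ × ℕ) × List (ℕ × ℕ)) × ℕ
  have hv := Primrec.fst.comp (Primrec.snd.comp (Primrec.fst (α := ℕ × (ℕ × ℕ) × List (ℕ × ℕ))
    (β := ℕ)))
  have hl := Primrec.snd.comp (Primrec.snd.comp (Primrec.fst (α := ℕ × (ℕ × ℕ) × List (ℕ × ℕ))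
    (β := ℕ)))
  have hw := Primrec.list_headI.comp hl
  have hv1 := ratPrimrec_ratOfNat (Primrec.fst.comp hv)
  have hv2 := ratPrimrec_ratOfNat (Primrec.snd.comp hv)
  have hw1 := ratPrimrec_ratOfNat (Primrec.fst.comp hw)
  have hw2 := ratPrimrec_ratOfNat (Primrec.snd.comp hw)
  have hih : RatPrimrec fun p : T => ratOfNat p.2 := ratPrimrec_ratOfNat .snd
  refine (RatPrimrec.list_rec (α := ℕ)
    (F := fun _ l => slopeSum (l.map (Prod.map ratOfNat ratOfNat)))
    (s := fun a ih => if a.2.2.length ≤ 0 then 0 else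
      |(ratOfNat a.2.2.headI.2 - ratOfNat a.2.1.2) /
        (ratOfNat a.2.2.headI.1 - ratOfNat a.2.1.1)| + ih)
    (ratPrimrec_zero.of_eq fun _ => rfl)
    (RatPrimrec.ite (Primrec.nat_le.comp (Primrec.list_length.comp hl) (.const 0))
      ratPrimrec_zero (((hw2.sub hv2).div (hw1.sub hv1)).abs.add hih)) ?_).comp
    (Primrec.id.pair (.const 0))
  intro x v l
  cases l <;> simp [slopeSum]

theorem IsConstructivePolygonalSeq.ratComputable_eval {h : ℕ → Polygonal}
    (hh : IsConstructivePolygonalSeq h) :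
    RatComputable fun p : ℕ × ℕ => interpolateRat (h p.1).nodes (ratOfNat p.2) := by
  obtain ⟨t, ht, e⟩ := hh
  exact (ratPrimrec_interpolateRat.ratComputable.comp
    ((ht.comp .fst).pair .snd)).of_eq fun p => by simp only [e]

theorem IsConstructivePolygonalSeq.ratComputable_slopeSum {h : ℕ → Polygonal}
    (hh : IsConstructivePolygonalSeq h) : RatComputable fun n => slopeSum (h n).nodes := by
  obtain ⟨t, ht, e⟩ := hh
  exact (ratPrimrec_slopeSum.ratComputable.comp ht).of_eq fun p => by simp only [e]

/-! ### Programs -/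

theorem Names.dom {c : Nat.Partrec.Code} {x : ℝ} (hc : Names c x) (n : ℕ) : (c.eval n).Dom :=
  let ⟨_, hm, _⟩ := hc n
  Part.dom_iff_mem.2 ⟨_, hm⟩

theorem Names.abs_sub_le {c : Nat.Partrec.Code} {x : ℝ} (hc : Names c x) {n m : ℕ}
    (hm : m ∈ c.eval n) : |((ratOfNat m : ℚ) : ℝ) - x| ≤ ((2 : ℝ) ^ n)⁻¹ := by
  obtain ⟨m', hm', h⟩ := hc n
  rwa [Part.mem_unique hm hm']

/-- The s-m-n theorem: a partial algorithm with a program as parameter becomes a total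
transformation of programs. -/
theorem exists_computable_code_eval {G : Nat.Partrec.Code → ℕ →. ℕ} (hG : Partrec₂ G) :
    ∃ F : Nat.Partrec.Code → Nat.Partrec.Code, Computable F ∧ ∀ c j, (F c).eval j = G c j := by
  have : Partrec fun p : ℕ => G (Denumerable.ofNat Nat.Partrec.Code p.unpair.1) p.unpair.2 :=
    hG.comp ((Computable.ofNat _).comp (Computable.fst.comp .unpair))
      (Computable.snd.comp .unpair)
  obtain ⟨e, he⟩ := Nat.Partrec.Code.exists_code.1 (Partrec.nat_iff.1 this)
  refine ⟨fun c => e.curry (Encodable.encode c), Nat.Partrec.Code.primrec₂_curry.to_comp.comp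
    (.const e) Computable.encode, fun c j => ?_⟩
  rw [Nat.Partrec.Code.eval_curry, he]
  simp

/-- Supplies a natural bound that can be read off the code; it converts a rational Lipschitz
constant into extra bits of precision. -/
theorem ratOfNat_le (k : ℕ) : ratOfNat k ≤ k.unpair.1 := by
  obtain ⟨a, b, c, e1, -, -, e⟩ := ratOfNat_eq_ratCode k
  rw [e, e1, div_le_iff₀ (by positivity)]
  have : (0 : ℚ) ≤ a * c := by positivity
  have : (0 : ℚ) ≤ b := by positivity
  linarith

theorem exists_ratOfNat (q : ℚ) : ∃ k, ratOfNat k = q := by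
  refine ⟨ratCode q.num.toNat (-q.num).toNat (q.den - 1), ?_⟩
  have h1 : ((q.num.toNat : ℤ) : ℚ) - ((-q.num).toNat : ℤ) = (q.num : ℚ) := by
    rw [← Int.cast_sub]; congr 1; omega
  have h2 : ((q.den - 1 : ℕ) : ℚ) + 1 = q.den := by
    rw [Nat.cast_sub q.pos]; simp
  rw [ratOfNat_ratCode, h2]
  have h3 := Rat.num_div_den q
  rw [← h1] at h3
  exact_mod_cast h3

theorem names_const (k : ℕ) : Names (Nat.Partrec.Code.const k) (ratOfNat k : ℝ) := fun n =>
  ⟨k, by simp, by simp⟩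

theorem isConstructiveReal_ratCast (q : ℚ) : IsConstructiveReal q := by
  obtain ⟨k, rfl⟩ := exists_ratOfNat q
  exact ⟨_, names_const k⟩

/-! ### Searching along the singular sequence for a value above one. -/

namespace IsSingularSequence

variable {h : ℕ → Polygonal}

theorem monotone_eval (hh : IsSingularSequence h) (x : ConstructivePoint) :
    Monotone fun n => (h n).eval x := monotone_nat_of_le_succ fun n => hh.mono n x

theorem eval_le (hh : IsSingularSequence h) (n : ℕ) (x : ConstructivePoint) :
    (h n).eval x ≤ 2 := (hh.monotone_eval x).ge_of_tendsto (hh.limit x) n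

theorem exists_one_lt (hh : IsSingularSequence h) (x : ConstructivePoint) :
    ∃ n, 1 < (h n).eval x :=
  ((hh.limit x).eventually (lt_mem_nhds one_lt_two)).exists

/-- An algorithm finds, given a program for `x`, an index with `1 < h n x`. -/
theorem exists_partrec_index (hh : IsSingularSequence h) :
    ∃ s : Nat.Partrec.Code →. ℕ, Partrec s ∧
      ∀ (x : ConstructivePoint) (c : Nat.Partrec.Code), Names c (x : ℝ) →
        ∃ n ∈ s c, 1 < (h n).eval x := by
  -- The first component codes `(n, j)`, the second a rational `q` with `|q - x| ≤ 2 ^ (-j)`. The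
  -- margin, Lipschitz constant times `2 ^ (-j)`, lets the decidable inequality at `q` certify `1 <
  -- h n x`.
  let D (p : ℕ × ℕ) : Bool := decide (1 + slopeSum (h p.1.unpair.1).nodes *
    ((2 : ℚ) ^ p.1.unpair.2)⁻¹ < interpolateRat (h p.1.unpair.1).nodes (ratOfNat p.2))
  have hD : Computable D := by
    have h1 : Computable fun p : ℕ × ℕ => p.1.unpair.1 := (Primrec.fst.unpair_fst).to_comp
    have h2 : Computable fun p : ℕ × ℕ => p.1.unpair.2 := (Primrec.fst.unpair_snd).to_comp
    exact RatComputable.decide_lt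
      (ratPrimrec_one.ratComputable.add
        ((hh.constructive.ratComputable_slopeSum.comp h1).mul (.inv_two_pow h2)))
      (hh.constructive.ratComputable_eval.comp (h1.pair Computable.snd))
  let P (c : Nat.Partrec.Code) (p : ℕ) : Part Bool := (c.eval p.unpair.2).map fun q => D (p, q)
  have hP : Partrec₂ P := by
    have : Partrec fun a : Nat.Partrec.Code × ℕ => a.1.eval a.2.unpair.2 :=
      Nat.Partrec.Code.eval_part.comp .fst Primrec.snd.unpair_snd.to_comp
    exact this.map (hD.comp ((Computable.snd.comp .fst).pair .snd)).to₂
  refine ⟨fun c => (Nat.rfind (P c)).map fun p => p.unpair.1,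
    (Partrec.rfind hP).map (Primrec.snd.unpair_fst.to_comp).to₂, fun x c hc => ?_⟩
  -- The search passes through all earlier candidates, so each test must halt; it does because `c`
  -- halts on every input.
  have hdom : ∀ p, (P c p).Dom := fun p => hc.dom _
  have key : ∀ n j m, m ∈ c.eval j →
      |(interpolateRat (h n).nodes (ratOfNat m) : ℝ) - (h n).eval x| ≤
        slopeSum (h n).nodes * ((2 : ℝ) ^ j)⁻¹ := fun n j m hm => by
    rw [← interpolate_ratCast]
    refine ((h n).abs_eval_sub_le _ _).trans ?_
    have := slopeSum_nonneg (h n).nodes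
    gcongr
    exact hc.abs_sub_le hm
  have hex : ∃ p, true ∈ P c p := by
    obtain ⟨n, hn⟩ := hh.exists_one_lt x
    -- The factor `2` pays once for the margin in the test and once for replacing `x` by its
    -- approximation.
    have hlim : Tendsto (fun j : ℕ => 1 + 2 * (slopeSum (h n).nodes * ((2 : ℝ) ^ j)⁻¹))
        atTop (𝓝 (1 + 2 * (slopeSum (h n).nodes * 0))) := by
      refine tendsto_const_nhds.add (tendsto_const_nhds.mul (tendsto_const_nhds.mul ?_))
      simpa [inv_pow] using
        tendsto_pow_atTop_nhds_zero_of_lt_one (r := (2 : ℝ)⁻¹) (by norm_num) (by norm_num)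
    obtain ⟨j, hj⟩ := (hlim.eventually (gt_mem_nhds (by simpa using hn))).exists
    obtain ⟨m, hm, -⟩ := hc j
    refine ⟨Nat.pair n j, ?_⟩
    simp only [P, Nat.unpair_pair]
    refine (Part.mem_map_iff _).2 ⟨m, hm, ?_⟩
    simp only [D, Nat.unpair_pair, decide_eq_true_eq]
    have := (abs_le.1 (key n j m hm)).1
    have h3 : (1 : ℝ) + slopeSum (h n).nodes * ((2 : ℝ) ^ j)⁻¹ <
        interpolateRat (h n).nodes (ratOfNat m) := by linarith
    exact (Rat.cast_lt (K := ℝ)).1 (by push_cast; exact h3)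
  obtain ⟨p₀, hp₀⟩ := hex
  obtain ⟨p, hp⟩ := Part.dom_iff_mem.1 (Nat.rfind_dom.2 ⟨p₀, hp₀, fun _ => hdom _⟩)
  refine ⟨p.unpair.1, (Part.mem_map_iff _).2 ⟨p, hp, rfl⟩, ?_⟩
  obtain ⟨m, hm, hD'⟩ := (Part.mem_map_iff _).1 (Nat.rfind_spec hp)
  simp only [D, decide_eq_true_eq] at hD'
  have h3 : (1 : ℝ) + slopeSum (h p.unpair.1).nodes * ((2 : ℝ) ^ p.unpair.2)⁻¹ <
      interpolateRat (h p.unpair.1).nodes (ratOfNat m) := by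
    have := (Rat.cast_lt (K := ℝ)).2 hD'
    push_cast at this
    exact this
  have := (abs_le.1 (key p.unpair.1 _ m hm)).2
  linarith

end IsSingularSequence

/-! ### Tent functions -/

/-- The tent function at rational points. -/
def tentRat (m : ℕ) (ζ β x : ℚ) : ℚ := ((2 : ℚ) ^ m)⁻¹ * max 0 (1 - |x - ζ| / β)

theorem tent_ratCast (m : ℕ) (ζ β x : ℚ) : tent m ζ β (x : ℝ) = (tentRat m ζ β x : ℝ) := by
  simp [tent, tentRat]

section Tent

variable {m : ℕ} {ζ β : ℚ}

theorem tent_nonneg (x : ℝ) : 0 ≤ tent m ζ β x :=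
  mul_nonneg (by positivity) (le_max_left _ _)

theorem tent_le (hβ : 0 < β) (x : ℝ) : tent m ζ β x ≤ ((2 : ℝ) ^ m)⁻¹ := by
  have hβ' : (0 : ℝ) < β := by exact_mod_cast hβ
  refine mul_le_of_le_one_right (by positivity) (max_le zero_le_one ?_)
  have : 0 ≤ |x - (ζ : ℝ)| / β := by positivity
  linarith

theorem tent_eq_zero (hβ : 0 < β) {x : ℝ} (hx : (β : ℝ) ≤ |x - ζ|) : tent m ζ β x = 0 := by
  have hβ' : (0 : ℝ) < β := by exact_mod_cast hβ
  rw [tent, max_eq_left, mul_zero]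
  rw [sub_nonpos, one_le_div hβ']
  exact hx

theorem abs_tent_sub_le (hβ : 0 < β) (x y : ℝ) :
    |tent m ζ β x - tent m ζ β y| ≤ ((2 : ℝ) ^ m)⁻¹ / β * |x - y| := by
  have hβ' : (0 : ℝ) < β := by exact_mod_cast hβ
  rw [tent, tent, ← mul_sub, abs_mul, abs_of_nonneg (by positivity : 0 ≤ ((2 : ℝ) ^ m)⁻¹),
    div_mul_eq_mul_div, mul_div_assoc]
  refine mul_le_mul_of_nonneg_left ?_ (by positivity)
  have h1 := abs_max_sub_max_le_max (0 : ℝ) (1 - |x - ζ| / β) 0 (1 - |y - ζ| / β)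
  refine h1.trans (max_le (by simpa using by positivity) ?_)
  rw [sub_sub_sub_cancel_left, ← sub_div, abs_div, abs_of_pos hβ']
  refine div_le_div_of_nonneg_right ?_ hβ'.le
  refine (abs_abs_sub_abs_le (y - ζ : ℝ) (x - ζ)).trans ?_
  rw [sub_sub_sub_cancel_right, abs_sub_comm]

theorem continuous_tent : Continuous (tent m ζ β) := by
  unfold tent
  fun_prop

end Tent

theorem ratComputable_tentRat {μ : ℕ → ℕ} (hμ : Computable μ) {ζ β : ℕ → ℚ}
    (hζ : IsConstructiveRatSeq ζ) (hβ : IsConstructiveRatSeq β) :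
    RatComputable fun p : ℕ × ℕ => tentRat (μ p.1) (ζ p.1) (β p.1) (ratOfNat p.2) := by
  have hζ' : RatComputable fun p : ℕ × ℕ => ζ p.1 := RatComputable.comp hζ .fst
  have hβ' : RatComputable fun p : ℕ × ℕ => β p.1 := RatComputable.comp hβ .fst
  exact (RatComputable.inv_two_pow (hμ.comp .fst)).mul
    (ratPrimrec_zero.ratComputable.max (ratPrimrec_one.ratComputable.sub
      (((ratComputable_ratOfNat .snd).sub hζ').abs.div hβ')))

theorem ratComputable_sum_tentRat {μ : ℕ → ℕ} (hμ : Computable μ) {ζ β : ℕ → ℚ}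
    (hζ : IsConstructiveRatSeq ζ) (hβ : IsConstructiveRatSeq β) :
    RatComputable fun p : ℕ × ℕ =>
      ∑ k ∈ Finset.range p.1, tentRat (μ k) (ζ k) (β k) (ratOfNat p.2) :=
  ((ratComputable_tentRat hμ hζ hβ).comp
    (Computable.snd.pair (Computable.snd.comp .fst))).sum_range (α := ℕ × ℕ)
      (φ := fun q : (ℕ × ℕ) × ℕ => tentRat (μ q.2) (ζ q.2) (β q.2) (ratOfNat q.1.2)) .fst

theorem HasSum.eq_sum_range_tent {μ : ℕ → ℕ} {ζ β : ℕ → ℚ} {x y : ℝ}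
    (h : HasSum (fun k => tent (μ k) (ζ k) (β k) x) y) {n : ℕ}
    (hn : ∀ k, n ≤ k → tent (μ k) (ζ k) (β k) x = 0) :
    y = ∑ k ∈ Finset.range n, tent (μ k) (ζ k) (β k) x :=
  h.unique (hasSum_sum_of_ne_finset_zero fun k hk => hn k (by simpa using hk))

/-- The bound `n` from `s` reduces the series to a sum of `n` terms with Lipschitz constant
`ratOfNat (A n)`. This is at most `2 ^ (A n).unpair.1`, so for accuracy `2 ^ (-j)` it suffices to
query `x` at precision `j + (A n).unpair.1`. -/
theorem isConstructiveFunction_of_hasSum_tent {μ : ℕ → ℕ} (hμ : Computable μ) {ζ β : ℕ → ℚ}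
    (hζ : IsConstructiveRatSeq ζ) (hβ : IsConstructiveRatSeq β) (hβ_pos : ∀ n, 0 < β n)
    {s : Nat.Partrec.Code →. ℕ} (hs : Partrec s)
    (hs' : ∀ (x : ConstructivePoint) (c : Nat.Partrec.Code), Names c (x : ℝ) →
      ∃ n ∈ s c, ∀ k : ℕ, n ≤ k → tent (μ k) (ζ k) (β k) x = 0)
    {f : ConstructivePoint → ℝ}
    (hf : ∀ x : ConstructivePoint, HasSum (fun k => tent (μ k) (ζ k) (β k) x) (f x)) :
    IsConstructiveFunction f := by
  have hΛ : RatComputable fun n : ℕ => ∑ k ∈ Finset.range n, ((2 : ℚ) ^ μ k)⁻¹ / β k :=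
    RatComputable.sum_range (α := ℕ) (φ := fun q : ℕ × ℕ => ((2 : ℚ) ^ μ q.2)⁻¹ / β q.2)
      ((RatComputable.inv_two_pow (hμ.comp .snd)).div (RatComputable.comp hβ .snd)) .id
  obtain ⟨A, hA, eA⟩ := hΛ
  obtain ⟨T, hT, eT⟩ := ratComputable_sum_tentRat hμ hζ hβ
  let G (c : Nat.Partrec.Code) (j : ℕ) : Part ℕ :=
    (s c).bind fun n => (c.eval (j + (A n).unpair.1)).map fun q => T (n, q)
  have hG : Partrec₂ G := by
    refine Partrec.bind (α := Nat.Partrec.Code × ℕ) (hs.comp .fst) ?_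
    refine Partrec.map (α := (Nat.Partrec.Code × ℕ) × ℕ)
      (Nat.Partrec.Code.eval_part.comp (Computable.fst.comp .fst)
        (Primrec.nat_add.to_comp.comp (Computable.snd.comp .fst)
          (Primrec.id.unpair_fst.to_comp.comp (hA.comp .snd)))) ?_
    exact hT.comp ((Computable.snd.comp .fst).pair .snd)
  obtain ⟨F, hF, eF⟩ := exists_computable_code_eval hG
  refine ⟨fun c => Part.some (F c), hF.partrec, fun x c hc => ⟨F c, Part.mem_some _, ?_⟩⟩
  intro j
  obtain ⟨n, hn, hz⟩ := hs' x c hc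
  obtain ⟨q, hq, hqx⟩ := hc (j + (A n).unpair.1)
  refine ⟨T (n, q), ?_, ?_⟩
  · rw [eF]
    exact Part.mem_bind hn ((Part.mem_map_iff _).2 ⟨q, hq, rfl⟩)
  rw [eT, (hf x).eq_sum_range_tent hz]
  push_cast
  simp only [← tent_ratCast]
  rw [← Finset.sum_sub_distrib]
  calc |∑ k ∈ Finset.range n, (tent (μ k) (ζ k) (β k) (ratOfNat q) - tent (μ k) (ζ k) (β k) x)|
      ≤ ∑ k ∈ Finset.range n, ((2 : ℝ) ^ μ k)⁻¹ / β k * |(ratOfNat q : ℝ) - x| :=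
        (Finset.abs_sum_le_sum_abs _ _).trans
          (Finset.sum_le_sum fun k _ => abs_tent_sub_le (hβ_pos k) _ _)
    _ = (ratOfNat (A n) : ℝ) * |(ratOfNat q : ℝ) - x| := by
        rw [eA, ← Finset.sum_mul]; push_cast; rfl
    _ ≤ (2 : ℝ) ^ (A n).unpair.1 * ((2 : ℝ) ^ (j + (A n).unpair.1))⁻¹ := by
        refine mul_le_mul ?_ hqx (abs_nonneg _) (by positivity)
        have h1 : (ratOfNat (A n) : ℝ) ≤ (A n).unpair.1 := by exact_mod_cast ratOfNat_le (A n)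
        have h2 : ((A n).unpair.1 : ℝ) ≤ (2 : ℝ) ^ (A n).unpair.1 := by
          exact_mod_cast Nat.lt_two_pow_self.le
        exact h1.trans h2
    _ = ((2 : ℝ) ^ j)⁻¹ := by
        rw [pow_add, mul_inv, mul_left_comm, mul_inv_cancel₀ (by positivity), mul_one]

/-! ### Oscillation -/

section Oscillation

variable {u : ℝ → ℝ} {Λ η x : ℝ}

theorem oscillationOn_le {B : ℝ} (hη : 0 ≤ η) (hx : x ∈ Icc (0 : ℝ) 1)
    (hB : ∀ t ∈ Icc (x - η) (x + η), ∀ s ∈ Icc (x - η) (x + η), |u t - u s| ≤ B) :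
    oscillationOn u η x ≤ B := by
  have hmem : x ∈ Icc (x - η) (x + η) ∩ Icc (0 : ℝ) 1 := ⟨⟨by linarith, by linarith⟩, hx⟩
  refine csSup_le ⟨_, x, hmem, x, hmem, rfl⟩ ?_
  rintro y ⟨t, ht, s, hs, rfl⟩
  exact hB t ht.1 s hs.1

theorem le_oscillationOn (hu : ∀ x y, |u x - u y| ≤ Λ * |x - y|) (hΛ : 0 ≤ Λ) {t s : ℝ}
    (ht : t ∈ Icc (x - η) (x + η) ∩ Icc (0 : ℝ) 1)
    (hs : s ∈ Icc (x - η) (x + η) ∩ Icc (0 : ℝ) 1) :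
    |u t - u s| ≤ oscillationOn u η x := by
  -- Boundedness is needed for `sSup` to be a true supremum; `Λ` works because two points of `[0,1]`
  -- are at distance at most `1`.
  refine le_csSup ⟨Λ, ?_⟩ ⟨t, ht, s, hs, rfl⟩
  rintro y ⟨t, ht, s, hs, rfl⟩
  refine (hu t s).trans (mul_le_of_le_one_right hΛ ?_)
  rw [abs_le]
  exact ⟨by linarith [ht.2.1, hs.2.2], by linarith [ht.2.2, hs.2.1]⟩

/-- Translate `t` by `y - x` and clamp to `[0,1]`. As `y` lies in `[0,1]`, clamping does not leave
the window around `y`; as `t` does too, it does not increase the displacement. -/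
theorem exists_mem_window {t y : ℝ} (hy : y ∈ Icc (0 : ℝ) 1)
    (ht : t ∈ Icc (x - η) (x + η) ∩ Icc (0 : ℝ) 1) :
    ∃ t' ∈ Icc (y - η) (y + η) ∩ Icc (0 : ℝ) 1, |t - t'| ≤ |x - y| := by
  obtain ⟨⟨h1, h2⟩, h3, h4⟩ := ht
  obtain ⟨hy0, hy1⟩ := hy
  refine ⟨max 0 (min 1 (y + (t - x))), ⟨⟨?_, ?_⟩, le_max_left _ _, ?_⟩, ?_⟩
  · rcases le_total 1 (y + (t - x)) with h | h
    · rw [min_eq_left h]; exact le_max_of_le_right (by linarith)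
    · rw [min_eq_right h]; exact le_max_of_le_right (by linarith)
  · exact max_le (by linarith) (min_le_of_right_le (by linarith))
  · exact max_le zero_le_one (min_le_left _ _)
  · rcases le_total x y with h | h
    · rw [abs_sub_comm x y, abs_of_nonneg (sub_nonneg.2 h), abs_sub_comm, abs_le]
      constructor
      · have : t ≤ max 0 (min 1 (y + (t - x))) :=
          le_max_of_le_right (le_min h4 (by linarith))
        linarith
      · rw [sub_le_iff_le_add]
        exact max_le (by linarith) (min_le_of_right_le (by linarith))
    · rw [abs_of_nonneg (sub_nonneg.2 h), abs_le]
      constructor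
      · have : max 0 (min 1 (y + (t - x))) ≤ t := max_le h3 (min_le_of_right_le (by linarith))
        linarith
      · have : t - (x - y) ≤ max 0 (min 1 (y + (t - x))) :=
          le_max_of_le_right (le_min (by linarith) (by linarith))
        linarith

/-- Both points of a pair in one window are moved into the other, each at a cost of `Λ * |x - y|`.
-/
theorem oscillationOn_le_add (hu : ∀ x y, |u x - u y| ≤ Λ * |x - y|) (hΛ : 0 ≤ Λ) (hη : 0 ≤ η)
    {y : ℝ} (hx : x ∈ Icc (0 : ℝ) 1) (hy : y ∈ Icc (0 : ℝ) 1) :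
    oscillationOn u η x ≤ oscillationOn u η y + 2 * Λ * |x - y| := by
  have hmem : x ∈ Icc (x - η) (x + η) ∩ Icc (0 : ℝ) 1 := ⟨⟨by linarith, by linarith⟩, hx⟩
  refine csSup_le ⟨_, x, hmem, x, hmem, rfl⟩ ?_
  rintro z ⟨t, ht, s, hs, rfl⟩
  obtain ⟨t', ht', htt⟩ := exists_mem_window hy ht
  obtain ⟨s', hs', hss⟩ := exists_mem_window hy hs
  have h1 := le_oscillationOn hu hΛ ht' hs'
  have h2 := (hu t t').trans (mul_le_mul_of_nonneg_left htt hΛ)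
  have h3 := (hu s s').trans (mul_le_mul_of_nonneg_left hss hΛ)
  rw [abs_le] at *
  constructor <;> linarith [h1.1, h1.2, h2.1, h2.2, h3.1, h3.2]

theorem continuousOn_oscillationOn (hu : ∀ x y, |u x - u y| ≤ Λ * |x - y|) (hΛ : 0 ≤ Λ)
    (hη : 0 ≤ η) : ContinuousOn (oscillationOn u η) (Icc 0 1) := by
  refine (LipschitzOnWith.of_dist_le_mul (K := (2 * Λ).toNNReal) fun x hx y hy => ?_).continuousOn
  rw [Real.coe_toNNReal _ (by positivity), Real.dist_eq, Real.dist_eq, abs_le]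
  have h1 := oscillationOn_le_add hu hΛ hη hx hy
  have h2 := oscillationOn_le_add hu hΛ hη hy hx
  rw [abs_sub_comm y x] at h2
  constructor <;> linarith

end Oscillation

/-! ### Sums of tent functions -/

section TentSum

variable {μ : ℕ → ℕ} {ζ β : ℕ → ℚ}

theorem abs_sum_tent_sub_le (hβ : ∀ n, 0 < β n) (s : Finset ℕ) (x y : ℝ) :
    |∑ k ∈ s, tent (μ k) (ζ k) (β k) x - ∑ k ∈ s, tent (μ k) (ζ k) (β k) y| ≤
      (∑ k ∈ s, ((2 : ℝ) ^ μ k)⁻¹ / β k) * |x - y| := by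
  rw [← Finset.sum_sub_distrib, Finset.sum_mul]
  exact (Finset.abs_sum_le_sum_abs _ _).trans
    (Finset.sum_le_sum fun k _ => abs_tent_sub_le (hβ k) _ _)

theorem sum_inv_div_nonneg (hβ : ∀ n, 0 < β n) (s : Finset ℕ) :
    0 ≤ ∑ k ∈ s, ((2 : ℝ) ^ μ k)⁻¹ / β k :=
  Finset.sum_nonneg fun k _ => by
    have : (0 : ℝ) < β k := by exact_mod_cast hβ k
    positivity

/-- In the minimum, `1` comes from the height and `2 * η / β` from the slope times the window width.
Outside the enlarged interval the window misses the support. -/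
theorem abs_tent_sub_le_of_window {m : ℕ} {ζ β : ℚ} (hβ : 0 < β) {η x t s : ℝ}
    (ht : t ∈ Icc (x - η) (x + η)) (hs : s ∈ Icc (x - η) (x + η)) :
    |tent m ζ β t - tent m ζ β s| ≤
      (Icc (ζ - (β + η)) (ζ + (β + η))).indicator
        (fun _ => ((2 : ℝ) ^ m)⁻¹ * min 1 (2 * η / β)) x := by
  have hβ' : (0 : ℝ) < β := by exact_mod_cast hβ
  by_cases hx : x ∈ Icc ((ζ : ℝ) - (β + η)) (ζ + (β + η))
  · rw [indicator_of_mem hx]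
    rcases min_choice 1 (2 * η / (β : ℝ)) with h | h <;> rw [h]
    · rw [mul_one]
      exact abs_sub_le_of_nonneg_of_le (tent_nonneg _) (tent_le hβ _) (tent_nonneg _)
        (tent_le hβ _)
    · refine (abs_tent_sub_le hβ t s).trans ?_
      rw [div_mul_eq_mul_div, ← mul_div_assoc]
      gcongr
      rw [abs_le]
      exact ⟨by linarith [ht.1, hs.2], by linarith [ht.2, hs.1]⟩
  · rw [indicator_of_notMem hx]
    have hfar : ∀ r ∈ Icc (x - η) (x + η), tent m ζ β r = 0 := fun r hr => by
      refine tent_eq_zero hβ ?_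
      by_contra hlt
      rw [not_le, abs_lt] at hlt
      exact hx ⟨by linarith [hr.1, hr.2, hlt.1, hlt.2], by linarith [hr.1, hr.2, hlt.1, hlt.2]⟩
    rw [hfar t ht, hfar s hs, sub_self, abs_zero]

/-- A wide tent (`η ≤ β`) is controlled by its slope, a narrow one by its height; either way `β`
cancels or is absorbed by `η`. -/
theorem window_area_le {m β η : ℝ} (hm : 0 ≤ m) (hβ : 0 < β) (hη : 0 < η) :
    2 * (β + η) * (m * min 1 (2 * η / β)) ≤ 8 * η * m := by
  have : (β + η) * min 1 (2 * η / β) ≤ 4 * η := by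
    rcases le_total η β with h | h
    · calc (β + η) * min 1 (2 * η / β) ≤ (β + β) * (2 * η / β) := by
            gcongr
            exact min_le_right _ _
        _ = 4 * η := by field_simp; ring
    · calc (β + η) * min 1 (2 * η / β) ≤ (η + η) * 1 := by
            gcongr
            exact min_le_left _ _
        _ ≤ 4 * η := by linarith
  nlinarith

theorem integral_indicator_Icc_le {a b c : ℝ} (hab : a ≤ b) (hc : 0 ≤ c) :
    ∫ x in (0 : ℝ)..1, (Icc a b).indicator (fun _ => c) x ≤ (b - a) * c := by
  rw [intervalIntegral.integral_of_le zero_le_one]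
  calc ∫ x in Ioc (0 : ℝ) 1, (Icc a b).indicator (fun _ => c) x
      ≤ ∫ x, (Icc a b).indicator (fun _ => c) x := by
        refine setIntegral_le_integral
          ((integrable_indicator_iff measurableSet_Icc).2 (integrableOn_const (by simp)))
          (Eventually.of_forall fun x => indicator_nonneg (fun _ _ => hc) x)
    _ = (b - a) * c := by
        rw [integral_indicator measurableSet_Icc, setIntegral_const]
        simp [hab]

theorem intervalIntegrable_indicator_Icc (a b c : ℝ) :
    IntervalIntegrable ((Icc a b).indicator fun _ => c) volume 0 1 := by
  refine Integrable.intervalIntegrable ?_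
  exact (integrable_indicator_iff measurableSet_Icc).2 (integrableOn_const (by simp))

/-- Distinct exponents make this a part of a finite geometric sum. -/
theorem sum_inv_two_pow_lt (hμ : Function.Injective μ) (s : Finset ℕ) :
    ∑ k ∈ s, ((2 : ℝ) ^ μ k)⁻¹ < 2 := by
  obtain ⟨M, hM⟩ : ∃ M, s.image μ ⊆ Finset.range M := (s.image μ).exists_nat_subset_range
  calc ∑ k ∈ s, ((2 : ℝ) ^ μ k)⁻¹ = ∑ m ∈ s.image μ, ((2 : ℝ) ^ m)⁻¹ :=
        (Finset.sum_image (f := fun m => ((2 : ℝ) ^ m)⁻¹) hμ.injOn).symm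
    _ ≤ ∑ m ∈ Finset.range M, ((2 : ℝ) ^ m)⁻¹ :=
        Finset.sum_le_sum_of_subset_of_nonneg hM fun _ _ _ => by positivity
    _ = 2 - 2 * ((2 : ℝ) ^ M)⁻¹ := by
        clear hM
        induction M with
        | zero => simp
        | succ M ih => rw [Finset.sum_range_succ, ih, pow_succ, mul_inv]; ring
    _ < 2 := by
        have : (0 : ℝ) < ((2 : ℝ) ^ M)⁻¹ := by positivity
        linarith

theorem continuousOn_oscillationOn_sum_tent (hβ : ∀ n, 0 < β n) (s : Finset ℕ) {η : ℝ}
    (hη : 0 ≤ η) :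
    ContinuousOn (oscillationOn (fun x => ∑ k ∈ s, tent (μ k) (ζ k) (β k) x) η) (Icc 0 1) :=
  continuousOn_oscillationOn (abs_sum_tent_sub_le hβ s) (sum_inv_div_nonneg hβ s) hη

/-- The bound depends neither on `s` nor on the widths, which is what allows passing to the infinite
series. The constant is `8 * 2`: area of one rectangle times total weight. -/
theorem integral_oscillationOn_sum_tent_lt (hμ : Function.Injective μ) (hβ : ∀ n, 0 < β n)
    (s : Finset ℕ) {η : ℝ} (hη : 0 < η) :
    ∫ x in (0 : ℝ)..1, oscillationOn (fun x => ∑ k ∈ s, tent (μ k) (ζ k) (β k) x) η x <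
      16 * η := by
  have hβ' : ∀ k, (0 : ℝ) < β k := fun k => by exact_mod_cast hβ k
  let J (k : ℕ) : ℝ → ℝ := (Icc ((ζ k : ℝ) - (β k + η)) (ζ k + (β k + η))).indicator
    (fun _ => ((2 : ℝ) ^ μ k)⁻¹ * min 1 (2 * η / β k))
  calc ∫ x in (0 : ℝ)..1, oscillationOn (fun x => ∑ k ∈ s, tent (μ k) (ζ k) (β k) x) η x
      ≤ ∫ x in (0 : ℝ)..1, ∑ k ∈ s, J k x := by
        have hJ : IntervalIntegrable (fun x => ∑ k ∈ s, J k x) volume 0 1 := by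
          simpa only [← Finset.sum_fn] using
            IntervalIntegrable.sum s fun k _ => intervalIntegrable_indicator_Icc _ _ _
        refine intervalIntegral.integral_mono_on zero_le_one
          (ContinuousOn.intervalIntegrable_of_Icc zero_le_one
            (continuousOn_oscillationOn_sum_tent hβ s hη.le))
          hJ
          fun x hx => oscillationOn_le hη.le hx fun t ht r hr => ?_
        rw [← Finset.sum_sub_distrib]
        exact (Finset.abs_sum_le_sum_abs _ _).trans
          (Finset.sum_le_sum fun k _ => abs_tent_sub_le_of_window (hβ k) ht hr)
    _ = ∑ k ∈ s, ∫ x in (0 : ℝ)..1, J k x :=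
        intervalIntegral.integral_finsetSum fun k _ => intervalIntegrable_indicator_Icc _ _ _
    _ ≤ ∑ k ∈ s, 8 * η * ((2 : ℝ) ^ μ k)⁻¹ := by
        refine Finset.sum_le_sum fun k _ => ?_
        have := hβ' k
        refine (integral_indicator_Icc_le (by linarith) (by positivity)).trans ?_
        refine le_trans (le_of_eq ?_) (window_area_le (by positivity) (hβ' k) hη)
        ring
    _ = 8 * η * ∑ k ∈ s, ((2 : ℝ) ^ μ k)⁻¹ := (Finset.mul_sum _ _ _).symm
    _ < 16 * η := by nlinarith [sum_inv_two_pow_lt hμ s]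

/-! ### Integral sums -/

/-- On a segment of length at most `d` the tag lies in the `d`-window of every point `x`, so `|u
(tag) - u x|` is at most the oscillation at `x`; integrate over the segments. -/
theorem TaggedPartition.abs_riemannSum_sub_integral_le (τ : TaggedPartition) {u : ℝ → ℝ}
    {Λ d : ℝ} (hu : ∀ x y, |u x - u y| ≤ Λ * |x - y|) (hΛ : 0 ≤ Λ) (hd : 0 ≤ d)
    (hτ : τ.MeshLE d) :
    |τ.riemannSum (fun x => u x) - ∫ x in (0 : ℝ)..1, u x| ≤
      ∫ x in (0 : ℝ)..1, oscillationOn u d x := by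
  -- The division points as a sequence on `ℕ`, for telescoping; the value `1` past the end keeps
  -- every term in `[0,1]`.
  let a (i : ℕ) : ℝ := if hi : i < τ.n + 1 then (τ.pt ⟨i, hi⟩ : ℝ) else 1
  have ha0 : a 0 = 0 := by simpa [a] using τ.pt_first
  have han : a τ.n = 1 := by simp only [a]; rw [dif_pos (Nat.lt_succ_self _)]; exact τ.pt_last
  have hac : ∀ i : Fin τ.n, a i = τ.pt i.castSucc := fun i => by
    simp only [a]; rw [dif_pos (by omega)]; rfl
  have has : ∀ i : Fin τ.n, a (i + 1) = τ.pt i.succ := fun i => by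
    simp only [a]; rw [dif_pos (by omega)]; rfl
  have hucont : Continuous u := (LipschitzWith.of_dist_le_mul (K := Λ.toNNReal) fun x y => by
    rw [Real.coe_toNNReal _ hΛ]; exact hu x y).continuous
  have hωcont := continuousOn_oscillationOn hu hΛ hd
  have ha01 : ∀ i, a i ∈ Icc (0 : ℝ) 1 := fun i => by
    simp only [a]
    split_ifs with hi
    · exact (τ.pt ⟨i, hi⟩).2.1
    · simp
  have hωint : ∀ i, IntervalIntegrable (oscillationOn u d) volume (a i) (a (i + 1)) :=
    fun i => (hωcont.mono ((convex_Icc _ _).ordConnected.uIcc_subset (ha01 i)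
      (ha01 _))).intervalIntegrable
  have hu_sum : ∑ i : Fin τ.n, ∫ x in a i..a (i + 1), u x = ∫ x in (0 : ℝ)..1, u x := by
    rw [Fin.sum_univ_eq_sum_range (fun i => ∫ x in a i..a (i + 1), u x),
      intervalIntegral.sum_integral_adjacent_intervals
        (fun k _ => hucont.intervalIntegrable _ _), ha0, han]
  have hω_sum : ∑ i : Fin τ.n, ∫ x in a i..a (i + 1), oscillationOn u d x =
      ∫ x in (0 : ℝ)..1, oscillationOn u d x := by
    rw [Fin.sum_univ_eq_sum_range (fun i => ∫ x in a i..a (i + 1), oscillationOn u d x),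
      intervalIntegral.sum_integral_adjacent_intervals (fun k _ => hωint k), ha0, han]
  rw [← hu_sum, ← hω_sum, TaggedPartition.riemannSum, ← Finset.sum_sub_distrib]
  refine (Finset.abs_sum_le_sum_abs _ _).trans (Finset.sum_le_sum fun i _ => ?_)
  have h1 := τ.pt_le_tag i
  have h2 := τ.tag_le_pt i
  have h3 := hτ i
  have hle : a i ≤ a (i + 1) := by rw [hac, has]; exact h1.trans h2
  have e : u (τ.tag i) * ((τ.pt i.succ : ℝ) - τ.pt i.castSucc) - ∫ x in a i..a (i + 1), u x =
      ∫ x in a i..a (i + 1), (u (τ.tag i) - u x) := by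
    rw [intervalIntegral.integral_sub (by simp) (hucont.intervalIntegrable _ _),
      intervalIntegral.integral_const, smul_eq_mul, hac, has, mul_comm]
  rw [e]
  refine (intervalIntegral.abs_integral_le_integral_abs hle).trans ?_
  refine intervalIntegral.integral_mono_on hle
    ((by fun_prop : Continuous fun x => |u (τ.tag i) - u x|).intervalIntegrable _ _)
    (hωint i) fun x hx => ?_
  rw [hac, has] at hx
  have hp := (τ.pt i.castSucc).2.1
  have hq := (τ.pt i.succ).2.1
  exact le_oscillationOn hu hΛ
    ⟨⟨by linarith [hx.2], by linarith [hx.1]⟩, (τ.tag i).2.1⟩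
    ⟨⟨by linarith, by linarith⟩, hp.1.trans hx.1, hx.2.trans hq.2⟩

end TentSum

/-! ### Integral sums of the series of tent functions -/

section TentSeries

variable {μ : ℕ → ℕ} {ζ β : ℕ → ℚ}

theorem summable_integral_tent (hμ : Function.Injective μ) (hβ : ∀ n, 0 < β n) :
    Summable fun k => ∫ x in (0 : ℝ)..1, tent (μ k) (ζ k) (β k) x := by
  have hg : Summable fun k => ((2 : ℝ) ^ μ k)⁻¹ := by
    have := (summable_geometric_of_lt_one (r := (2 : ℝ)⁻¹) (by norm_num)
      (by norm_num)).comp_injective hμ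
    simpa only [Function.comp_def, inv_pow] using this
  refine hg.of_nonneg_of_le
    (fun k => intervalIntegral.integral_nonneg zero_le_one fun x _ => tent_nonneg x) fun k => ?_
  calc ∫ x in (0 : ℝ)..1, tent (μ k) (ζ k) (β k) x ≤ ∫ _ in (0 : ℝ)..1, ((2 : ℝ) ^ μ k)⁻¹ :=
        intervalIntegral.integral_mono_on zero_le_one (continuous_tent.intervalIntegrable _ _)
          (by simp) fun x _ => tent_le (hβ k) x
    _ = ((2 : ℝ) ^ μ k)⁻¹ := by simp

/-- From some `m` on, the partial sums agree with `f` at all the finitely many tags, so the integral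
sum is constant in `m` while the integrals of the partial sums converge. -/
theorem TaggedPartition.abs_riemannSum_sub_tsum_le (τ : TaggedPartition)
    (hμ : Function.Injective μ) (hβ : ∀ n, 0 < β n) {f : ConstructivePoint → ℝ}
    (hf : ∀ x : ConstructivePoint, ∃ n, ∀ m, n ≤ m →
      f x = ∑ k ∈ Finset.range m, tent (μ k) (ζ k) (β k) x)
    {d : ℝ} (hd : 0 < d) (hτ : τ.MeshLE d) :
    |τ.riemannSum f - ∑' k, ∫ x in (0 : ℝ)..1, tent (μ k) (ζ k) (β k) x| ≤ 16 * d := by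
  have hlim := (summable_integral_tent (ζ := ζ) hμ hβ).hasSum.tendsto_sum_nat
  refine le_of_tendsto (tendsto_const_nhds.sub hlim).abs ?_
  have hev : ∀ᶠ m in atTop, ∀ i : Fin τ.n,
      f (τ.tag i) = ∑ k ∈ Finset.range m, tent (μ k) (ζ k) (β k) (τ.tag i) :=
    eventually_all.2 fun i => eventually_atTop.2 (hf (τ.tag i))
  filter_upwards [hev] with m hm
  have e : τ.riemannSum f = τ.riemannSum
      (fun x => (fun y : ℝ => ∑ k ∈ Finset.range m, tent (μ k) (ζ k) (β k) y) x) :=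
    Finset.sum_congr rfl fun i _ => by rw [hm i]
  rw [e, ← intervalIntegral.integral_finsetSum fun k _ => continuous_tent.intervalIntegrable _ _]
  exact (τ.abs_riemannSum_sub_integral_le (abs_sum_tent_sub_le hβ _)
    (sum_inv_div_nonneg hβ _) hd.le hτ).trans
      (integral_oscillationOn_sum_tent_lt hμ hβ _ hd).le

end TentSeries

/-! ### Uniform partitions -/

/-- The dyadic point `i / 2 ^ p`. -/
def dyadic (p i : ℕ) : ℚ := i * ((2 : ℚ) ^ p)⁻¹

/-- The dyadic point `i / 2 ^ p` of `[0,1]`. -/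
def dyadicPoint (p i : ℕ) (hi : i ≤ 2 ^ p) : ConstructivePoint :=
  ⟨(dyadic p i : ℚ), by
    have h : (i : ℝ) ≤ 2 ^ p := by exact_mod_cast hi
    simp only [dyadic]
    push_cast
    rw [← div_eq_mul_inv]
    exact ⟨by positivity, (div_le_one (by positivity)).2 h⟩, isConstructiveReal_ratCast _⟩

theorem dyadic_succ_sub (p i : ℕ) :
    ((dyadic p (i + 1) : ℚ) : ℝ) - (dyadic p i : ℚ) = ((2 : ℝ) ^ p)⁻¹ := by
  simp only [dyadic]
  push_cast
  ring

/-- The partition of `[0,1]` into `2 ^ p` equal segments tagged by their left ends. -/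
def uniformPartition (p : ℕ) : TaggedPartition where
  n := 2 ^ p
  pt i := dyadicPoint p i (Nat.lt_succ_iff.1 i.2)
  tag i := dyadicPoint p i i.2.le
  pt_first := by simp [dyadicPoint, dyadic]
  pt_last := by simp [dyadicPoint, dyadic]
  pt_le_tag _ := le_rfl
  tag_le_pt i := sub_nonneg.1 <| by
    refine le_of_le_of_eq ?_ (dyadic_succ_sub p i).symm
    positivity

theorem meshLE_uniformPartition (p : ℕ) : (uniformPartition p).MeshLE ((2 : ℝ) ^ p)⁻¹ :=
  fun i => (dyadic_succ_sub p i).le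

theorem riemannSum_uniformPartition (p : ℕ) (f : ConstructivePoint → ℝ) :
    (uniformPartition p).riemannSum f =
      ∑ i : Fin (2 ^ p), f (dyadicPoint p i i.2.le) * ((2 : ℝ) ^ p)⁻¹ :=
  Finset.sum_congr rfl fun i _ => congrArg _ (dyadic_succ_sub p i)

theorem ratComputable_dyadic {α : Type*} [Primcodable α] {p i : α → ℕ} (hp : Computable p)
    (hi : Computable i) : RatComputable fun a => dyadic (p a) (i a) :=
  ((ratPrimrec_natCast .id).ratComputable.comp hi).mul (.inv_two_pow hp)

/-! ### Computing the integral from dyadic integral sums. -/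

namespace IsSingularSequence

variable {h : ℕ → Polygonal}

/-- A single rational inequality that certifies `h n > 1` at all dyadic tags at once; it is
eventually true since each of the finitely many terms tends to `0`. -/
theorem exists_sum_dyadic_lt (hh : IsSingularSequence h) (p : ℕ) :
    ∃ n, ∑ i ∈ Finset.range (2 ^ p), (2 - interpolateRat (h n).nodes (dyadic p i)) < 1 := by
  have hlim : Tendsto (fun n => ∑ i ∈ Finset.range (2 ^ p),
      ((2 : ℝ) - (h n).eval (dyadic p i : ℚ))) atTop
      (𝓝 (∑ i ∈ Finset.range (2 ^ p), ((2 : ℝ) - 2))) :=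
    tendsto_finsetSum _ fun i hi => tendsto_const_nhds.sub
      (hh.limit (dyadicPoint p i (Finset.mem_range.1 hi).le))
  obtain ⟨n, hn⟩ := (hlim.eventually (gt_mem_nhds
    (show ∑ i ∈ Finset.range (2 ^ p), ((2 : ℝ) - 2) < 1 by simp))).exists
  refine ⟨n, (Rat.cast_lt (K := ℝ)).1 ?_⟩
  simpa only [Polygonal.eval, interpolate_ratCast, Rat.cast_sum, Rat.cast_sub, Rat.cast_ofNat,
    Rat.cast_one] using hn

/-- All terms are non-negative because `h n ≤ 2`, so each one is below `1`. -/
theorem one_lt_of_sum_dyadic_lt (hh : IsSingularSequence h) {p n : ℕ}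
    (hn : ∑ i ∈ Finset.range (2 ^ p), (2 - interpolateRat (h n).nodes (dyadic p i)) < 1)
    {i : ℕ} (hi : i < 2 ^ p) : 1 < (h n).eval (dyadic p i : ℚ) := by
  have hcast : ∀ i, (h n).eval (dyadic p i : ℚ) = (interpolateRat (h n).nodes (dyadic p i) : ℚ) :=
    fun i => interpolate_ratCast _ _
  have h0 : ∀ j ∈ Finset.range (2 ^ p), 0 ≤ 2 - interpolateRat (h n).nodes (dyadic p j) :=
    fun j hj => by
      have := hh.eval_le n (dyadicPoint p j (Finset.mem_range.1 hj).le)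
      change (h n).eval (dyadic p j : ℚ) ≤ 2 at this
      rw [hcast] at this
      exact sub_nonneg.2 (by exact_mod_cast this)
  have h1 := (Finset.single_le_sum h0 (Finset.mem_range.2 hi)).trans_lt hn
  rw [hcast]
  have : 1 < interpolateRat (h n).nodes (dyadic p i) := by linarith
  exact_mod_cast this

/-- A real number approximated by the integral sums of the series of tent functions is constructive. -/
theorem isConstructiveReal_of_approx (hh : IsSingularSequence h) {μ : ℕ → ℕ}
    (hμ : Computable μ) {ζ β : ℕ → ℚ} (hζ : IsConstructiveRatSeq ζ)
    (hβ : IsConstructiveRatSeq β) {f : ConstructivePoint → ℝ} {I : ℝ}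
    (hf : ∀ (x : ConstructivePoint) (n : ℕ), 1 < (h n).eval x →
      f x = ∑ k ∈ Finset.range n, tent (μ k) (ζ k) (β k) x)
    (hI : ∀ p, |(uniformPartition p).riemannSum f - I| ≤ 16 * ((2 : ℝ) ^ p)⁻¹) :
    IsConstructiveReal I := by
  have hp1 : Computable fun q : (ℕ × ℕ) × ℕ => q.1.1 := Computable.fst.comp .fst
  have hp2 : Computable fun q : (ℕ × ℕ) × ℕ => q.1.2 := Computable.snd.comp .fst
  have hN : Computable fun q : ℕ × ℕ => 2 ^ q.1 := Primrec.two_pow.to_comp.comp .fst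
  have hd : RatComputable fun q : (ℕ × ℕ) × ℕ => dyadic q.1.1 q.2 :=
    ratComputable_dyadic hp1 .snd
  have hD : Computable fun q : ℕ × ℕ => decide
      (∑ i ∈ Finset.range (2 ^ q.1), (2 - interpolateRat (h q.2).nodes (dyadic q.1 i)) < 1) :=
    RatComputable.decide_lt
      (RatComputable.sum_range (α := ℕ × ℕ)
        (φ := fun q => 2 - interpolateRat (h q.1.2).nodes (dyadic q.1.1 q.2))
        (RatComputable.sub ((ratPrimrec_natCast (.const 2)).ratComputable.of_eq fun _ => by simp)
          (hh.constructive.ratComputable_eval.subst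
            (ψ := fun n x => interpolateRat (h n).nodes x) hp2 hd)) hN)
      ratPrimrec_one.ratComputable
  have hR : RatComputable fun q : ℕ × ℕ => ∑ i ∈ Finset.range (2 ^ q.1),
      (∑ k ∈ Finset.range q.2, tentRat (μ k) (ζ k) (β k) (dyadic q.1 i)) * ((2 : ℚ) ^ q.1)⁻¹ :=
    RatComputable.sum_range (α := ℕ × ℕ)
      (φ := fun q => (∑ k ∈ Finset.range q.1.2, tentRat (μ k) (ζ k) (β k) (dyadic q.1.1 q.2)) *
        ((2 : ℚ) ^ q.1.1)⁻¹)
      (RatComputable.mul ((ratComputable_sum_tentRat hμ hζ hβ).subst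
        (ψ := fun n x => ∑ k ∈ Finset.range n, tentRat (μ k) (ζ k) (β k) x) hp2 hd)
        (.inv_two_pow hp1)) hN
  obtain ⟨T, hT, eT⟩ := hR
  let P (p n : ℕ) : Bool := decide
    (∑ i ∈ Finset.range (2 ^ p), (2 - interpolateRat (h n).nodes (dyadic p i)) < 1)
  have hP : Computable₂ P := hD
  -- Find an `n` valid at all tags, then output the integral sum, in which `f` may be replaced by
  -- its first `n` terms.
  let G (p : ℕ) : Part ℕ := (Nat.rfind (P p : ℕ →. Bool)).map fun n => T (p, n)
  have hG : Partrec G := (Partrec.rfind hP.partrec₂).map hT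
  have hG_mem : ∀ p, ∃ m ∈ G p, (ratOfNat m : ℝ) = (uniformPartition p).riemannSum f := fun p => by
    obtain ⟨n₀, hn₀⟩ := hh.exists_sum_dyadic_lt p
    obtain ⟨n, hn, -⟩ := Nat.rfind_min' (p := P p) (m := n₀) (decide_eq_true hn₀)
    refine ⟨T (p, n), (Part.mem_map_iff _).2 ⟨n, hn, rfl⟩, ?_⟩
    have hPn : P p n = true := (Part.mem_some_iff.1 (Nat.rfind_spec hn)).symm
    rw [eT, riemannSum_uniformPartition]
    dsimp only
    rw [Finset.sum_range]
    push_cast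
    refine Finset.sum_congr rfl fun i _ => ?_
    rw [hf (dyadicPoint p i i.2.le) n (hh.one_lt_of_sum_dyadic_lt (of_decide_eq_true hPn) i.2)]
    simp only [← tent_ratCast]
    rfl
  -- `16 * 2 ^ (-(j + 4)) = 2 ^ (-j)`.
  have hadd : Computable fun j : ℕ => j + 4 :=
    (Primrec.nat_add.comp .id (.const 4)).to_comp
  obtain ⟨c, hc⟩ := Nat.Partrec.Code.exists_code.1 (Partrec.nat_iff.1 (hG.comp hadd))
  refine ⟨c, fun j => ?_⟩
  obtain ⟨m, hm, e⟩ := hG_mem (j + 4)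
  refine ⟨m, by rw [hc]; exact hm, ?_⟩
  rw [e]
  refine (hI (j + 4)).trans (le_of_eq ?_)
  rw [pow_add, mul_inv]
  ring

end IsSingularSequence

theorem mainTheorem2
    (A : ℕ → NormalAlgorithm) (hA : IsNumbering A)
    (μ : ℕ → ℕ) (hμ : IsDiagonalEnumeration A μ)
    (δ : ℕ → ℚ) (g : ℕ → Polygonal)
    (hδg : ∀ n, DiagonalOutput A (μ n) (δ n) (g n))
    (h : ℕ → Polygonal) (hh : IsSingularSequence h)
    (ν : ℕ → ℕ) (hν : Computable ν) (hν_mono : StrictMono ν)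
    (ζ β : ℕ → ℚ) (hζ : IsConstructiveRatSeq ζ) (hβ : IsConstructiveRatSeq β)
    (hζ_mem : ∀ n, ζ n ∈ Set.Ioo (0 : ℚ) 1) (hβ_pos : ∀ n, 0 < β n)
    (hβ_lt : ∀ n, β n < min (δ n) (min (ζ n) (1 - ζ n)))
    (hsep : ∀ (n : ℕ) (x : ConstructivePoint),
      (x : ℝ) ∈ Set.Icc ((ζ n : ℝ) - (β n : ℝ)) ((ζ n : ℝ) + (β n : ℝ)) →
        (g n).eval x + (h (ν n)).eval x < 1 ∧ 1 < (h (ν (n + 1))).eval x) :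
    -- at every point the sum is finite, and an algorithm bounds the non-zero terms
    (∃ s : Nat.Partrec.Code →. ℕ, Partrec s ∧
      ∀ (x : ConstructivePoint) (c : Nat.Partrec.Code), Names c (x : ℝ) →
        ∃ n ∈ s c, ∀ k : ℕ, n ≤ k → tent (μ k) (ζ k) (β k) x = 0) ∧
    -- the uniform bound on the oscillation integrals
    (∀ ε : ℝ, 0 < ε → ∀ n : ℕ,
      ContinuousOn
        (oscillationOn (fun x => ∑ k ∈ Finset.range (n + 1), tent (μ k) (ζ k) (β k) x) (ε / 16))
        (Set.Icc 0 1) ∧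
      ∫ x in (0 : ℝ)..1,
        oscillationOn (fun x => ∑ k ∈ Finset.range (n + 1), tent (μ k) (ζ k) (β k) x) (ε / 16) x
          < ε) ∧
    -- the sum is a constructive function, and it is constructively Riemann integrable
    (∃ f : ConstructivePoint → ℝ,
      (∀ x : ConstructivePoint, HasSum (fun k => tent (μ k) (ζ k) (β k) x) (f x)) ∧
      IsConstructiveFunction f ∧
      ConstructivelyRiemannIntegrable f) := by
  have hzero : ∀ (x : ConstructivePoint) (n : ℕ), 1 < (h n).eval x →
      ∀ k, n ≤ k → tent (μ k) (ζ k) (β k) x = 0 := fun x n hn k hk => by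
    refine tent_eq_zero (hβ_pos k) ?_
    by_contra hlt
    rw [not_le, abs_lt] at hlt
    have h1 := (hsep k x ⟨by linarith [hlt.1], by linarith [hlt.2]⟩).1
    have h2 : (0 : ℝ) ≤ (g k).eval x := (hδg k).2.2.1 x
    -- Strict monotonicity of `ν` gives `n ≤ k ≤ ν k`, hence `1 < h (ν k) x`, against `h1` and `h2`.
    have h3 := hh.monotone_eval x (hk.trans (hν_mono.id_le k))
    dsimp only at h3
    linarith
  obtain ⟨s, hs, hs'⟩ := hh.exists_partrec_index
  have hs₀ : ∀ (x : ConstructivePoint) (c : Nat.Partrec.Code), Names c (x : ℝ) →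
      ∃ n ∈ s c, ∀ k : ℕ, n ≤ k → tent (μ k) (ζ k) (β k) x = 0 := fun x c hc => by
    obtain ⟨n, hn, hx⟩ := hs' x c hc
    exact ⟨n, hn, hzero x n hx⟩
  refine ⟨⟨s, hs, hs₀⟩, fun ε hε n =>
    ⟨continuousOn_oscillationOn_sum_tent hβ_pos _ (by positivity), ?_⟩, ?_⟩
  · have := integral_oscillationOn_sum_tent_lt (ζ := ζ) hμ.injective hβ_pos
      (Finset.range (n + 1)) (η := ε / 16) (by positivity)
    linarith
  have hf : ∀ x : ConstructivePoint, HasSum (fun k => tent (μ k) (ζ k) (β k) x)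
      (∑' k, tent (μ k) (ζ k) (β k) x) := fun x => by
    obtain ⟨n, hn⟩ := hh.exists_one_lt x
    exact (summable_of_ne_finset_zero (s := Finset.range n) fun k hk =>
      hzero x n hn k (by simpa using hk)).hasSum
  have hf_eq : ∀ (x : ConstructivePoint) (n : ℕ), 1 < (h n).eval x →
      ∑' k, tent (μ k) (ζ k) (β k) x = ∑ k ∈ Finset.range n, tent (μ k) (ζ k) (β k) x :=
    fun x n hn => (hf x).eq_sum_range_tent (hzero x n hn)
  have hRS : ∀ (τ : TaggedPartition) (r : ℕ), τ.MeshLE ((2 : ℝ) ^ r)⁻¹ →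
      |τ.riemannSum (fun x => ∑' k, tent (μ k) (ζ k) (β k) x) -
        ∑' k, ∫ x in (0 : ℝ)..1, tent (μ k) (ζ k) (β k) x| ≤ 16 * ((2 : ℝ) ^ r)⁻¹ :=
    fun τ r hτ => τ.abs_riemannSum_sub_tsum_le hμ.injective hβ_pos (fun x => by
      obtain ⟨n, hn⟩ := hh.exists_one_lt x
      exact ⟨n, fun m hm => hf_eq x m (hn.trans_le (hh.monotone_eval x hm))⟩)
      (by positivity) hτ
  refine ⟨fun x => ∑' k, tent (μ k) (ζ k) (β k) x, hf,
    isConstructiveFunction_of_hasSum_tent hμ.computable hζ hβ hβ_pos hs hs₀ hf,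
    ∑' k, ∫ x in (0 : ℝ)..1, tent (μ k) (ζ k) (β k) x,
    hh.isConstructiveReal_of_approx hμ.computable hζ hβ hf_eq
      fun p => hRS _ p (meshLE_uniformPartition p),
    -- `16 * 2 ^ (-(k + 5))` is half of `2 ^ (-k)`, which gives the strict inequality.
    fun k => k + 5, (Primrec.nat_add.comp .id (.const 5)).to_comp, fun k τ hτ => ?_⟩
  refine (hRS τ _ hτ).trans_lt ?_
  have : (0 : ℝ) < ((2 : ℝ) ^ k)⁻¹ := by positivity
  rw [pow_add, mul_inv]
  linarith
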